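/- Let $V$ be any set (of variables; possibly empty). \emph{Terms} are built from variables with a binary operation symbol: every variable is a term, and $t_1\cdot t_2$ is a term whenever $t_1,t_2$ are. \emph{Formulae} are $t\leq s$ (for terms $t,s$), the constant $\top$, and conjunctions $A\wedge B$ of formulae. \emph{Arrow terms} $f:A\vdash B$ are generated from the primitive arrow terms $\mathbf 1_A:A\vdash A$; $b^{\to}_{A,B,C}:A\wedge(B\wedge C)\vdash(A\wedge B)\wedge C$; $b^{\leftarrow}_{A,B,C}:(A\wedge B)\wedge C\vdash A\wedge(B\wedge C)$; $\delta^{\to}_A:A\wedge\top\vdash A$; $\delta^{\leftarrow}_A:A\vdash A\wedge\top$; $\sigma^{\to}_A:\top\wedge A\vdash A$; $\sigma^{\leftarrow}_A:A\vdash\top\wedge A$; $c_{A,B}:A\wedge B\vdash B\wedge A$; $r_t:\top\vdash t\leq t$; $t_{t,s,u}:t\leq s\wedge s\leq u\vdash t\leq u$; $a_{t_1,t_2,t_3,t_4}:t_1\leq t_2\wedge t_3\leq t_4\vdash t_1\cdot t_3\leq t_2\cdot t_4$ by composition $g\circ f:A\vdash C$ (for $f:A\vdash B$, $g:B\vdash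 C$) and by $f\wedge g:A\wedge C\vdash B\wedge D$ (for $f:A\vdash B$, $g:C\vdash D$). The category $\dot S_\leq$ has the formulae as objects; its arrows are the equivalence classes of arrow terms under the smallest equivalence relation that is a congruence for $\circ$ and $\wedge$ and satisfies: the category axioms; functoriality of $\wedge$ in both arguments; naturality of $b^{\to},\delta^{\to},\sigma^{\to},c$; the equations saying that $b^{\leftarrow},\delta^{\leftarrow},\sigma^{\leftarrow}$ are inverse to $b^{\to},\delta^{\to},\sigma^{\to}$ and that $c_{B,A}$ is inverse to $c_{A,B}$; the pentagon equation $b^{\to}_{A\wedge B,C,D}\circ b^{\to}_{A,B,C\wedge D}=(b^{\to}_{A,B,C}\wedge\mathbf 1_D)\circ b^{\to}_{A,B\wedge C,D}\circ(\mathbf 1_A\wedge b^{\to}_{B,C,D})$; the triangle equation $b^{\to}_{A,\top,C}=(\delta^{\leftarrow}_A\wedge\mathbf 1_C)\circ(\mathbf 1_A\wedge\sigma^{\to}_C)$; the hexagon equation $c_{A,B\wedge C}=b^{\to}_{B,C,A}\circ(\mathbf 1_B\wedge c_{A,C})\circ b^{\leftarrow}_{B,A,C}\circ(c_{A,B}\wedge\mathbf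 1_C)\circ b^{\to}_{A,B,C}$; and, for all terms, \begin{itemize} \item $t_{x,y,y}\circ(\mathbf 1_{x\leq y}\wedge r_y)=\delta^{\to}_{x\leq y}$ and $t_{y,y,x}\circ(r_y\wedge\mathbf 1_{y\leq x})=\sigma^{\to}_{y\leq x}$; \item $t_{x,y,u}\circ(\mathbf 1_{x\leq y}\wedge t_{y,z,u})=t_{x,z,u}\circ(t_{x,y,z}\wedge\mathbf 1_{z\leq u})\circ b^{\to}_{x\leq y,y\leq z,z\leq u}$; \item (ra) $a_{t,t,s,s}\circ(r_t\wedge r_s)\circ\delta^{\leftarrow}_\top=r_{t\cdot s}$; \item (ta) $a_{t_1,r_1,t_2,r_2}\circ(t_{t_1,s_1,r_1}\wedge t_{t_2,s_2,r_2})=t_{t_1\cdot t_2,\,s_1\cdot s_2,\,r_1\cdot r_2}\circ(a_{t_1,s_1,t_2,s_2}\wedge a_{s_1,r_1,s_2,r_2})\circ c^m_{t_1\leq s_1,\,s_1\leq r_1,\,t_2\leq s_2,\,s_2\leq r_2}$, where $c^m_{A,B,C,D}=b^{\to}_{A,C,B\wedge D}\circ(\mathbf 1_A\wedge(b^{\leftarrow}_{C,B,D}\circ(c_{B,C}\wedge\mathbf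 1_D)\circ b^{\to}_{B,C,D}))\circ b^{\leftarrow}_{A,B,C\wedge D}$. \end{itemize} Let $\mathit{Br}$ be the category whose objects are the finite ordinals and whose arrows $m\to n$ are the equivalence relations on the disjoint union of $m$ and $n$ all of whose classes have exactly two elements; the composite of two such relations is the restriction to the outer ordinals of the equivalence relation generated by their union, so that closed loops are forgotten. The functor $G:\dot S_\leq\to\mathit{Br}$ sends a formula to its number of occurrences of variables. It sends $\mathbf 1,b^{\to},b^{\leftarrow},\delta^{\to},\delta^{\leftarrow},\sigma^{\to},\sigma^{\leftarrow}$ to parallel lines; $c_{A,B}$ to the crossing of the block of lines of $A$ with that of $B$; $r_t$ to caps joining the $i$-th occurrences of variables in the two copies of $t$; $t_{t,s,u}$ to cups joining the $i$-th occurrences in the two copies of $s$, with parallel lines for $t$ and $u$; $a_{t_1,t_2,t_3,t_4}$ to blocks of parallel lines for $t_1,t_2,t_3,t_4$, with the blocks of $t_2$ and $t_3$ crossing; $\wedge$ to horizontal and $\circ$ to vertical composition of diagrams. Then $\dot S_\leq$ is coherent, i.e. $G$ is faithful: if $f,g:A\vdash B$ and $Gf=Gg$, then $f=g$ in $\dot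 S_\leq$. -/

import Mathlib

open CategoryTheory

universe u v

/-! ## Brauerian split equivalences -/

/-- A Brauerian split equivalence between `α` (the source) and `β` (the target): an equivalence
relation on the disjoint union of `α` and `β` all of whose classes have exactly two elements. -/
structure BrRel (α : Type u) (β : Type v) where
  rel : Setoid (α ⊕ β)
  brauerian : ∀ x, ∃! y, y ≠ x ∧ rel x y

namespace BrRel

section general

variable {α α' β β' γ δ : Type*}

/-- The split equivalence whose classes are the sets `{x, s x}`, for a fixed-point-free
involution `s`. -/
def ofInvolution (s : α ⊕ β → α ⊕ β) (hs : ∀ x, s (s x) = x) (hne : ∀ x, s x ≠ x) :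
    BrRel α β where
  rel :=
    { r := fun x y => y = x ∨ y = s x
      iseqv :=
        { refl := fun x => Or.inl rfl
          symm := by
            rintro x y (rfl | rfl)
            · exact Or.inl rfl
            · exact Or.inr (hs x).symm
          trans := by
            rintro x y z (rfl | rfl) (rfl | rfl)
            · exact Or.inl rfl
            · exact Or.inr rfl
            · exact Or.inr rfl
            · exact Or.inl (hs x) } }
  brauerian x := ⟨s x, ⟨hne x, Or.inr rfl⟩, fun y hy => hy.2.resolve_left hy.1⟩

/-- Parallel lines joining `a` in the source with `e a` in the target. -/
def ofEquiv (e : α ≃ β) : BrRel α β :=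
  ofInvolution (Sum.elim (fun a => Sum.inr (e a)) (fun b => Sum.inl (e.symm b)))
    (by rintro (a | b) <;> simp) (by rintro (a | b) <;> simp)

/-- Caps: nothing in the source, and the two copies of each `a` in the target joined. -/
def cap (ε α : Type*) [IsEmpty ε] : BrRel ε (α ⊕ α) :=
  ofInvolution (Sum.elim isEmptyElim (fun b => Sum.inr b.swap))
    (by rintro (a | b | b) <;> first | exact isEmptyElim a | simp)
    (by rintro (a | b | b) <;> first | exact isEmptyElim a | simp)

/-- Cups: nothing in the target, and the two copies of each `a` in the source joined. -/
def cup (α ε : Type*) [IsEmpty ε] : BrRel (α ⊕ α) ε :=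
  ofInvolution (Sum.elim (fun b => Sum.inl b.swap) isEmptyElim)
    (by rintro ((b | b) | a) <;> first | exact isEmptyElim a | simp)
    (by rintro ((b | b) | a) <;> first | exact isEmptyElim a | simp)

/-- Renaming of the elements of source and target. -/
def reindex (e : α ≃ α') (f : β ≃ β') (R : BrRel α β) : BrRel α' β' where
  rel := R.rel.comap (Equiv.sumCongr e f).symm
  brauerian x := by
    obtain ⟨y, ⟨hy, hxy⟩, hu⟩ := R.brauerian ((Equiv.sumCongr e f).symm x)
    refine ⟨Equiv.sumCongr e f y, ⟨fun h => hy ?_, ?_⟩, fun z hz => ?_⟩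
    · rw [← h, Equiv.symm_apply_apply]
    · rw [Setoid.comap_rel, Equiv.symm_apply_apply]; exact hxy
    · rw [← hu ((Equiv.sumCongr e f).symm z)
        ⟨fun h => hz.1 ((Equiv.sumCongr e f).symm.injective h), hz.2⟩, Equiv.apply_symm_apply]

/-- The disjoint union of two setoids. -/
def sumSetoid (r : Setoid α) (s : Setoid β) : Setoid (α ⊕ β) where
  r := Sum.LiftRel r s
  iseqv :=
    { refl := by
        rintro (a | b)
        · exact .inl (r.refl a)
        · exact .inr (s.refl b)
      symm := by
        rintro _ _ (h | h)
        · exact .inl (r.symm h)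
        · exact .inr (s.symm h)
      trans := by
        rintro _ _ _ (h | h) (h' | h')
        · exact .inl (r.trans h h')
        · exact .inr (s.trans h h') }

/-- Horizontal composition: the two diagrams side by side. -/
def tensor (R : BrRel α β) (S : BrRel α' β') : BrRel (α ⊕ α') (β ⊕ β') where
  rel := (sumSetoid R.rel S.rel).comap (Equiv.sumSumSumComm α α' β β')
  brauerian x := by
    set e := Equiv.sumSumSumComm α α' β β'
    suffices h : ∀ u, ∃! v, v ≠ u ∧ sumSetoid R.rel S.rel u v by
      obtain ⟨y, ⟨hy, hxy⟩, hu⟩ := h (e x)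
      refine ⟨e.symm y, ⟨fun h => hy ?_, ?_⟩, fun z hz => ?_⟩
      · rw [← h, Equiv.apply_symm_apply]
      · rw [Setoid.comap_rel, Equiv.apply_symm_apply]; exact hxy
      · rw [← hu (e z) ⟨fun h => hz.1 (e.injective h), hz.2⟩, Equiv.symm_apply_apply]
    rintro (a | b)
    · obtain ⟨y, ⟨hy, hxy⟩, hu⟩ := R.brauerian a
      refine ⟨Sum.inl y, ⟨fun h => hy (Sum.inl_injective h), .inl hxy⟩, ?_⟩
      rintro _ ⟨hz, h | h⟩
      rw [hu _ ⟨fun h => hz (congrArg _ h), h⟩]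
    · obtain ⟨y, ⟨hy, hxy⟩, hu⟩ := S.brauerian b
      refine ⟨Sum.inr y, ⟨fun h => hy (Sum.inr_injective h), .inr hxy⟩, ?_⟩
      rintro _ ⟨hz, h | h⟩
      rw [hu _ ⟨fun h => hz (congrArg _ h), h⟩]

/-- Inclusion of the upper diagram in the three-layer picture. -/
def upper : α ⊕ β → α ⊕ β ⊕ γ := Sum.elim Sum.inl (fun b => Sum.inr (Sum.inl b))

/-- Inclusion of the lower diagram in the three-layer picture. -/
def lower : β ⊕ γ → α ⊕ β ⊕ γ := Sum.inr

/-- Inclusion of the top and the bottom layer in the three-layer picture. -/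
def outer : α ⊕ γ → α ⊕ β ⊕ γ := Sum.elim Sum.inl (fun c => Sum.inr (Sum.inr c))

/-- The union of two split equivalences that share the middle layer. -/
inductive Glue (R : BrRel α β) (S : BrRel β γ) : α ⊕ β ⊕ γ → α ⊕ β ⊕ γ → Prop
  | up {x y} : R.rel x y → Glue R S (upper x) (upper y)
  | low {x y} : S.rel x y → Glue R S (lower x) (lower y)

/-- The equivalence relation generated by the union, restricted to the outer layers. -/
def compRel (R : BrRel α β) (S : BrRel β γ) : Setoid (α ⊕ γ) :=
  (Relation.EqvGen.setoid (Glue R S)).comap outer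

theorem exists_involution (R : BrRel α β) : ∃ s : α ⊕ β → α ⊕ β,
    (∀ x, s (s x) = x) ∧ (∀ x, s x ≠ x) ∧ ∀ x y, R.rel x y ↔ y = x ∨ y = s x := by
  choose s hs hu using R.brauerian
  refine ⟨s, fun x => ?_, fun x => (hs x).1, fun x y => ⟨fun h => ?_, ?_⟩⟩
  · exact (hu (s x) x ⟨(hs x).1.symm, R.rel.symm (hs x).2⟩).symm
  · by_cases hxy : y = x
    · exact Or.inl hxy
    · exact Or.inr (hu x y ⟨hxy, h⟩)
  · rintro (rfl | rfl)
    · exact R.rel.refl _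
    · exact (hs x).2

theorem dihedral_orbit {X : Type*} [Finite X] (σ τ : Equiv.Perm X) (hσ : σ * σ = 1)
    (hτ : τ * τ = 1) (x : X) (hx : τ x = x) (hne : σ x ≠ x) (E : X → Prop)
    (hE0 : E x) (hEσ : ∀ y, E y → E (σ y)) (hEτ : ∀ y, E y → E (τ y))
    (hEmin : ∀ P : X → Prop, P x → (∀ y, P y → P (σ y)) → (∀ y, P y → P (τ y)) →
      ∀ y, E y → P y) :
    ∃! y, y ≠ x ∧ (σ y = y ∨ τ y = y) ∧ E y := by
  have hσi : σ⁻¹ = σ := inv_eq_of_mul_eq_one_left hσ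
  have hτi : τ⁻¹ = τ := inv_eq_of_mul_eq_one_left hτ
  set ρ : Equiv.Perm X := τ * σ with hρ
  have hρi : ρ⁻¹ = σ * τ := by rw [hρ, mul_inv_rev, hσi, hτi]
  have t1 : ∀ k : ℤ, τ ((ρ ^ k) x) = (ρ ^ (-k)) x := by
    intro k
    have h : SemiconjBy τ ρ ρ⁻¹ := by
      show τ * ρ = ρ⁻¹ * τ
      rw [hρi, hρ, mul_assoc σ, hτ, ← mul_assoc, hτ, one_mul, mul_one]
    have h2 := congrArg (fun g : Equiv.Perm X => g x) (h.zpow_right k).eq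
    simpa [Equiv.Perm.mul_apply, hx] using h2
  have hσρ : ∀ y, σ y = τ (ρ y) := by
    intro y
    show σ y = (τ * (τ * σ)) y
    rw [← mul_assoc, hτ, one_mul]
  have s1 : ∀ k : ℤ, σ ((ρ ^ k) x) = (ρ ^ (-(k + 1))) x := by
    intro k
    rw [hσρ, ← t1]
    congr 1
    rw [add_comm, zpow_add, zpow_one]; rfl
  have horb : ∀ y, E y ↔ ∃ k : ℤ, y = (ρ ^ k) x := by
    intro y
    constructor
    · refine hEmin (fun y => ∃ k : ℤ, y = (ρ ^ k) x) ⟨0, by simp⟩ ?_ ?_ y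
      · rintro _ ⟨k, rfl⟩; exact ⟨_, s1 k⟩
      · rintro _ ⟨k, rfl⟩; exact ⟨_, t1 k⟩
    · rintro ⟨k, rfl⟩
      induction k using Int.induction_on with
      | zero => simpa using hE0
      | succ n ih =>
        rw [add_comm, zpow_add, zpow_one]
        exact hEτ _ (hEσ _ ih)
      | pred n ih =>
        rw [sub_eq_add_neg, add_comm, zpow_add, zpow_neg_one, hρi]
        exact hEσ _ (hEτ _ ih)
  set L := MulAction.period ρ x with hL
  have hLpos : 0 < L := MulAction.period_pos_of_orderOf_pos (orderOf_pos ρ) x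
  have per : ∀ i j : ℤ, (ρ ^ i) x = (ρ ^ j) x ↔ (L : ℤ) ∣ i - j := by
    intro i j
    rw [hL, ← MulAction.zpow_smul_eq_iff_period_dvd, Equiv.Perm.smul_def, sub_eq_add_neg, add_comm,
      zpow_add, Equiv.Perm.mul_apply, zpow_neg, Equiv.Perm.inv_eq_iff_eq]
  have per0 : ∀ i : ℤ, (ρ ^ i) x = x ↔ (L : ℤ) ∣ i := by
    intro i
    simpa using per i 0
  have fτ : ∀ k : ℤ, τ ((ρ ^ k) x) = (ρ ^ k) x ↔ (L : ℤ) ∣ 2 * k := by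
    intro k
    rw [t1, per, ← dvd_neg]
    have : -(-k - k) = 2 * k := by ring
    rw [this]
  have fσ : ∀ k : ℤ, σ ((ρ ^ k) x) = (ρ ^ k) x ↔ (L : ℤ) ∣ 2 * k + 1 := by
    intro k
    rw [s1, per, ← dvd_neg]
    have : -(-(k + 1) - k) = 2 * k + 1 := by ring
    rw [this]
  have hL1 : ¬ (L : ℤ) ∣ 1 := by
    intro h
    exact hne (by simpa using (fσ 0).2 (by simpa using h))
  obtain ⟨m, hm | hm⟩ := Nat.even_or_odd' L
  · refine ⟨(ρ ^ (m : ℤ)) x, ⟨?_, ?_, ?_⟩, ?_⟩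
    · rw [Ne, per0]
      intro h
      have := Int.le_of_dvd (by omega) h
      omega
    · right; rw [fτ]; rw [hm]; push_cast; exact dvd_rfl
    · exact (horb _).2 ⟨_, rfl⟩
    · rintro y ⟨hyx, hy, hEy⟩
      obtain ⟨k, rfl⟩ := (horb y).1 hEy
      rw [Ne, per0] at hyx
      rw [fτ, fσ] at hy
      rw [per]
      rcases hy with hy | hy
      · exfalso
        have h2 : (2 : ℤ) ∣ 2 * k + 1 := Dvd.dvd.trans ⟨m, by rw [hm]; push_cast; ring⟩ hy
        omega
      · obtain ⟨c, hc⟩ := hy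
        rw [hm] at hc hyx ⊢
        push_cast at hc hyx ⊢
        have hk : k = m * c := by linarith
        obtain ⟨d, hd | hd⟩ := Int.even_or_odd' c
        · exact absurd ⟨d, by rw [hk, hd]; ring⟩ hyx
        · exact ⟨d, by rw [hk, hd]; ring⟩
  · refine ⟨(ρ ^ (m : ℤ)) x, ⟨?_, ?_, ?_⟩, ?_⟩
    · rw [Ne, per0]
      intro h
      apply hL1
      have h3 : (L : ℤ) ∣ L - 2 * m := dvd_sub dvd_rfl (Dvd.dvd.mul_left h 2)
      rw [hm] at h3 ⊢
      push_cast at h3 ⊢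
      simpa using h3
    · left; rw [fσ]; rw [hm]; push_cast; exact dvd_rfl
    · exact (horb _).2 ⟨_, rfl⟩
    · rintro y ⟨hyx, hy, hEy⟩
      obtain ⟨k, rfl⟩ := (horb y).1 hEy
      rw [Ne, per0] at hyx
      rw [fτ, fσ] at hy
      rw [per]
      have hcop : IsCoprime (L : ℤ) 2 := ⟨1, -m, by rw [hm]; push_cast; ring⟩
      rcases hy with hy | hy
      · have h4 : (L : ℤ) ∣ 2 * (k - m) := by
          have e : 2 * (k - m) = 2 * k + 1 - (L : ℤ) := by omega
          rw [e]
          exact dvd_sub hy dvd_rfl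
        exact hcop.dvd_of_dvd_mul_left h4
      · exact absurd (hcop.dvd_of_dvd_mul_left hy) hyx

/-- Composition: vertical composition of diagrams; closed loops in the middle are forgotten. -/
def comp [Finite α] [Finite β] [Finite γ] (R : BrRel α β) (S : BrRel β γ) : BrRel α γ where
  rel := compRel R S
  brauerian x := by
    obtain ⟨s, hs, hsne, hsR⟩ := exists_involution R
    obtain ⟨t, ht, htne, htS⟩ := exists_involution S
    let σ₀ : α ⊕ β ⊕ γ → α ⊕ β ⊕ γ := Sum.elim (fun a => upper (s (Sum.inl a)))
      (Sum.elim (fun b => upper (s (Sum.inr b))) (fun c => Sum.inr (Sum.inr c)))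
    let τ₀ : α ⊕ β ⊕ γ → α ⊕ β ⊕ γ := Sum.elim Sum.inl (fun y => lower (t y))
    have σu : ∀ y, σ₀ (upper y) = upper (s y) := by rintro (a | b) <;> rfl
    have τl : ∀ y, τ₀ (lower y) = lower (t y) := fun _ => rfl
    have inju : Function.Injective (upper : α ⊕ β → α ⊕ β ⊕ γ) := by
      rintro (a | b) (a' | b') h <;> simp_all [upper]
    have injo : Function.Injective (outer : α ⊕ γ → α ⊕ β ⊕ γ) := by
      rintro (a | b) (a' | b') h <;> simp_all [outer]
    have hσ₀ : Function.Involutive σ₀ := by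
      rintro (a | b | c)
      · exact (σu (s (Sum.inl a))).trans (congrArg _ (hs _))
      · exact (σu (s (Sum.inr b))).trans (congrArg _ (hs _))
      · rfl
    have hτ₀ : Function.Involutive τ₀ := by
      rintro (a | y)
      · rfl
      · exact (τl (t y)).trans (congrArg _ (ht _))
    let σ := hσ₀.toPerm
    let τ := hτ₀.toPerm
    have hσ : σ * σ = 1 := Equiv.ext hσ₀
    have hτ : τ * τ = 1 := Equiv.ext hτ₀
    let E := Relation.EqvGen (Glue R S)
    have Eσ : ∀ y, E y (σ₀ y) := by
      rintro (a | b | c)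
      · exact .rel _ _ (Glue.up (x := Sum.inl a) ((hsR _ _).2 (Or.inr rfl)))
      · exact .rel _ _ (Glue.up (x := Sum.inr b) ((hsR _ _).2 (Or.inr rfl)))
      · exact .refl _
    have Eτ : ∀ y, E y (τ₀ y) := by
      rintro (a | y)
      · exact .refl _
      · exact .rel _ _ (Glue.low ((htS _ _).2 (Or.inr rfl)))
    have Emin : ∀ P : α ⊕ β ⊕ γ → Prop, (∀ y, P y → P (σ₀ y)) → (∀ y, P y → P (τ₀ y)) →
        ∀ y z, E y z → P y → P z := by
      intro P h1 h2
      have key : ∀ y z, E y z → (P y ↔ P z) := by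
        intro y z h
        induction h with
        | rel y z h =>
          cases h with
          | up h =>
            rename_i y z
            rcases (hsR _ _).1 h with rfl | rfl
            · exact Iff.rfl
            · rw [← σu]
              exact ⟨h1 _, fun h => by simpa [hσ₀ (upper y)] using h1 _ h⟩
          | low h =>
            rename_i y z
            rcases (htS _ _).1 h with rfl | rfl
            · exact Iff.rfl
            · rw [← τl]
              exact ⟨h2 _, fun h => by simpa [hτ₀ (lower y)] using h2 _ h⟩
        | refl => exact Iff.rfl
        | symm _ _ _ ih => exact ih.symm
        | trans _ _ _ _ _ ih1 ih2 => exact ih1.trans ih2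
      exact fun y z h => (key y z h).1
    have fixo : ∀ y, (σ₀ y = y ∨ τ₀ y = y) ↔ ∃ z, y = outer z := by
      rintro (a | b | c)
      · exact ⟨fun _ => ⟨Sum.inl a, rfl⟩, fun _ => Or.inr rfl⟩
      · constructor
        · rintro (h | h)
          · exact absurd (inju (a₂ := Sum.inr b) h) (hsne _)
          · exact absurd (Sum.inr_injective h) (htne _)
        · rintro ⟨z | z, h⟩ <;> simp [outer] at h
      · exact ⟨fun _ => ⟨Sum.inr c, rfl⟩, fun _ => Or.inl rfl⟩
    have main : ∃! y, y ≠ outer x ∧ (σ₀ y = y ∨ τ₀ y = y) ∧ E (outer x) y := by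
      rcases x with a | c
      · refine dihedral_orbit σ τ hσ hτ (outer (Sum.inl a)) rfl ?_ (E (outer (Sum.inl a))) (.refl _)
          (fun y h => .trans _ _ _ h (Eσ y)) (fun y h => .trans _ _ _ h (Eτ y))
          (fun P h0 h1 h2 y h => Emin P h1 h2 _ _ h h0)
        exact fun h => hsne _ (inju (a₂ := Sum.inl a) h)
      · have := dihedral_orbit τ σ hτ hσ (outer (Sum.inr c)) rfl
          (fun h => htne _ (Sum.inr_injective (a₂ := Sum.inr c) h))
          (E (outer (Sum.inr c))) (.refl _)
          (fun y h => .trans _ _ _ h (Eτ y)) (fun y h => .trans _ _ _ h (Eσ y))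
          (fun P h0 h1 h2 y h => Emin P h2 h1 _ _ h h0)
        obtain ⟨y, ⟨h1, h2, h3⟩, h4⟩ := this
        exact ⟨y, ⟨h1, h2.symm, h3⟩, fun z hz => h4 z ⟨hz.1, hz.2.1.symm, hz.2.2⟩⟩
    obtain ⟨y, ⟨hy, hfix, hE⟩, hu⟩ := main
    obtain ⟨z, rfl⟩ := (fixo y).1 hfix
    refine ⟨z, ⟨fun h => hy (congrArg _ h), hE⟩, fun z' hz' => injo ?_⟩
    exact hu _ ⟨fun h => hz'.1 (injo h), (fixo _).2 ⟨_, rfl⟩, hz'.2⟩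

/-- A pair of predicates on source and target that is constant on the classes of `R`.
This is an auxiliary notion, used to check equations between split equivalences. -/
def Inv (R : BrRel α β) (p : α → Prop) (q : β → Prop) : Prop :=
  ∀ x y, R.rel x y → Sum.elim p q x = Sum.elim p q y

theorem ext_inv {R S : BrRel α β} (h : ∀ p q, R.Inv p q ↔ S.Inv p q) : R = S := by
  have key : ∀ R S : BrRel α β, (∀ p q, R.Inv p q ↔ S.Inv p q) →
      ∀ x y, R.rel x y → S.rel x y := by
    intro R S h x y hxy
    have hS : S.Inv (fun a => S.rel x (Sum.inl a)) (fun b => S.rel x (Sum.inr b)) := by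
      have e : Sum.elim (fun a => S.rel x (Sum.inl a)) (fun b => S.rel x (Sum.inr b))
          = fun z => S.rel x z := by
        funext z; rcases z with a | b <;> rfl
      intro y z hyz
      rw [e]
      exact propext ⟨fun h => S.rel.trans h hyz, fun h => S.rel.trans h (S.rel.symm hyz)⟩
    have e : Sum.elim (fun a => S.rel x (Sum.inl a)) (fun b => S.rel x (Sum.inr b))
        = fun z => S.rel x z := by
      funext z; rcases z with a | b <;> rfl
    have h1 := (h _ _).2 hS x y hxy
    rw [e] at h1
    exact h1.mp (S.rel.refl x)
  have hrel : R.rel = S.rel :=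
    Setoid.ext fun x y => ⟨key R S h x y, key S R (fun p q => (h p q).symm) x y⟩
  cases R; cases S; cases hrel; rfl

theorem inv_ofInvolution (s : α ⊕ β → α ⊕ β) (hs hne) (p : α → Prop) (q : β → Prop) :
    (ofInvolution s hs hne).Inv p q ↔ ∀ x, Sum.elim p q x = Sum.elim p q (s x) := by
  constructor
  · exact fun h x => h x (s x) (Or.inr rfl)
  · rintro h x y (rfl | rfl)
    · rfl
    · exact h x

theorem inv_ofEquiv (e : α ≃ β) (p : α → Prop) (q : β → Prop) :
    (ofEquiv e).Inv p q ↔ ∀ a, p a = q (e a) := by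
  rw [ofEquiv, inv_ofInvolution, Sum.forall]
  constructor
  · exact fun h => h.1
  · refine fun h => ⟨h, fun b => ?_⟩
    simp [h]

theorem inv_cap (ε : Type*) [IsEmpty ε] (p : ε → Prop) (q : α ⊕ α → Prop) :
    (cap ε α).Inv p q ↔ ∀ a, q (Sum.inl a) = q (Sum.inr a) := by
  rw [cap, inv_ofInvolution, Sum.forall, Sum.forall]
  constructor
  · exact fun h => h.2.1
  · exact fun h => ⟨fun a => isEmptyElim a, h, fun a => (h a).symm⟩

theorem inv_cup (ε : Type*) [IsEmpty ε] (p : α ⊕ α → Prop) (q : ε → Prop) :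
    (cup α ε).Inv p q ↔ ∀ a, p (Sum.inl a) = p (Sum.inr a) := by
  rw [cup, inv_ofInvolution, Sum.forall, Sum.forall]
  constructor
  · exact fun h => h.1.1
  · exact fun h => ⟨⟨h, fun a => (h a).symm⟩, fun a => isEmptyElim a⟩

theorem inv_reindex (e : α ≃ α') (f : β ≃ β') (R : BrRel α β) (p : α' → Prop) (q : β' → Prop) :
    (R.reindex e f).Inv p q ↔ R.Inv (p ∘ e) (q ∘ f) := by
  have E : ∀ z, Sum.elim (p ∘ e) (q ∘ f) z = Sum.elim p q (Equiv.sumCongr e f z) := by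
    rintro (a | b) <;> rfl
  constructor
  · intro h x y hxy
    rw [E, E]
    refine h _ _ ?_
    show R.rel _ _
    rwa [Equiv.symm_apply_apply, Equiv.symm_apply_apply]
  · intro h x y hxy
    have := h _ _ hxy
    rwa [E, E, Equiv.apply_symm_apply, Equiv.apply_symm_apply] at this

theorem inv_tensor (R : BrRel α β) (S : BrRel α' β') (p : α ⊕ α' → Prop) (q : β ⊕ β' → Prop) :
    (R.tensor S).Inv p q ↔
      R.Inv (p ∘ Sum.inl) (q ∘ Sum.inl) ∧ S.Inv (p ∘ Sum.inr) (q ∘ Sum.inr) := by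
  set e := Equiv.sumSumSumComm α α' β β' with he
  have E1 : ∀ z, Sum.elim (p ∘ Sum.inl) (q ∘ Sum.inl) z = Sum.elim p q (e.symm (Sum.inl z)) := by
    rintro (a | b) <;> rfl
  have E2 : ∀ z, Sum.elim (p ∘ Sum.inr) (q ∘ Sum.inr) z = Sum.elim p q (e.symm (Sum.inr z)) := by
    rintro (a | b) <;> rfl
  constructor
  · intro h
    constructor
    · intro x y hxy
      rw [E1, E1]
      refine h _ _ ?_
      show Sum.LiftRel _ _ (e _) (e _)
      rw [Equiv.apply_symm_apply, Equiv.apply_symm_apply]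
      exact .inl hxy
    · intro x y hxy
      rw [E2, E2]
      refine h _ _ ?_
      show Sum.LiftRel _ _ (e _) (e _)
      rw [Equiv.apply_symm_apply, Equiv.apply_symm_apply]
      exact .inr hxy
  · rintro ⟨h1, h2⟩ x y hxy
    have key : ∀ u v, Sum.LiftRel R.rel S.rel u v →
        Sum.elim p q (e.symm u) = Sum.elim p q (e.symm v) := by
      rintro _ _ (h | h)
      · rw [← E1, ← E1]; exact h1 _ _ h
      · rw [← E2, ← E2]; exact h2 _ _ h
    have h3 := key (e x) (e y) hxy
    rwa [Equiv.symm_apply_apply, Equiv.symm_apply_apply] at h3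

theorem inv_comp [Finite α] [Finite β] [Finite γ] (R : BrRel α β) (S : BrRel β γ)
    (p : α → Prop) (q : γ → Prop) :
    (R.comp S).Inv p q ↔ ∃ m, R.Inv p m ∧ S.Inv m q := by
  constructor
  · intro h
    let T : α ⊕ β ⊕ γ → Prop := fun y =>
      ∃ z, Sum.elim p q z ∧ Relation.EqvGen (Glue R S) (outer z) y
    have hT : ∀ y z, Relation.EqvGen (Glue R S) y z → T y = T z := fun y z hyz =>
      propext ⟨fun ⟨u, hu, hr⟩ => ⟨u, hu, .trans _ _ _ hr hyz⟩,
        fun ⟨u, hu, hr⟩ => ⟨u, hu, .trans _ _ _ hr (.symm _ _ hyz)⟩⟩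
    have hTo : ∀ y, T (outer y) = Sum.elim p q y := fun y =>
      propext ⟨fun ⟨u, hu, hr⟩ => (h _ _ hr).mp hu, fun hy => ⟨y, hy, .refl _⟩⟩
    have e1 : ∀ x, Sum.elim p (fun b => T (Sum.inr (Sum.inl b))) x = T (upper x) := by
      rintro (a | b)
      · exact (hTo (Sum.inl a)).symm
      · rfl
    have e2 : ∀ x, Sum.elim (fun b => T (Sum.inr (Sum.inl b))) q x = T (lower x) := by
      rintro (a | b)
      · rfl
      · exact (hTo (Sum.inr b)).symm
    refine ⟨fun b => T (Sum.inr (Sum.inl b)), fun x y hxy => ?_, fun x y hxy => ?_⟩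
    · rw [e1, e1]; exact hT _ _ (.rel _ _ (.up hxy))
    · rw [e2, e2]; exact hT _ _ (.rel _ _ (.low hxy))
  · rintro ⟨m, hR, hS⟩ x y hxy
    let T : α ⊕ β ⊕ γ → Prop := Sum.elim p (Sum.elim m q)
    have eu : ∀ x, T (upper x) = Sum.elim p m x := by rintro (a | b) <;> rfl
    have eo : ∀ x, T (outer x) = Sum.elim p q x := by rintro (a | b) <;> rfl
    have hT : ∀ y z, Relation.EqvGen (Glue R S) y z → T y = T z := by
      intro y z h
      induction h with
      | rel y z h =>
        cases h with
        | up h => rw [eu, eu]; exact hR _ _ h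
        | low h => exact hS _ _ h
      | refl => rfl
      | symm _ _ _ ih => exact ih.symm
      | trans _ _ _ _ _ ih1 ih2 => exact ih1.trans ih2
    rw [← eo, ← eo]
    exact hT _ _ hxy

end general

end BrRel

/-! ## The category Br -/

/-- Objects of the category Br: finite ordinals. -/
structure Br where
  card : ℕ

namespace Br

/-- Arrows from `m` to `n` are Brauerian split equivalences between `m` and `n`. -/
instance : Category.{0} Br where
  Hom m n := BrRel (Fin m.card) (Fin n.card)
  id m := BrRel.ofEquiv (Equiv.refl _)
  comp R S := BrRel.comp R S
  id_comp R := BrRel.ext_inv fun p q => by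
    rw [BrRel.inv_comp]
    constructor
    · rintro ⟨m, h1, h2⟩
      have : p = m := funext ((BrRel.inv_ofEquiv _ _ _).1 h1)
      rwa [this]
    · exact fun h => ⟨p, (BrRel.inv_ofEquiv _ _ _).2 fun _ => rfl, h⟩
  comp_id R := BrRel.ext_inv fun p q => by
    rw [BrRel.inv_comp]
    constructor
    · rintro ⟨m, h1, h2⟩
      have : m = q := funext ((BrRel.inv_ofEquiv _ _ _).1 h2)
      rwa [← this]
    · exact fun h => ⟨q, h, (BrRel.inv_ofEquiv _ _ _).2 fun _ => rfl⟩
  assoc R S T := BrRel.ext_inv fun p q => by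
    simp only [BrRel.inv_comp]
    constructor
    · rintro ⟨m, ⟨n, h1, h2⟩, h3⟩
      exact ⟨n, h1, m, h2, h3⟩
    · rintro ⟨n, h1, m, h2, h3⟩
      exact ⟨m, ⟨n, h1, h2⟩, h3⟩

/-- Parallel lines between equal finite ordinals. -/
def lines {m n : ℕ} (h : m = n) : Br.mk m ⟶ Br.mk n := BrRel.ofEquiv (finCongr h)

/-- Horizontal composition of diagrams. -/
def tensor {m n m' n' : ℕ} (f : Br.mk m ⟶ Br.mk n) (g : Br.mk m' ⟶ Br.mk n') :
    Br.mk (m + m') ⟶ Br.mk (n + n') :=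
  (BrRel.tensor f g).reindex finSumFinEquiv finSumFinEquiv

/-- A block of `m` parallel lines crossing a block of `n` parallel lines. -/
def cross (m n : ℕ) : Br.mk (m + n) ⟶ Br.mk (n + m) := BrRel.ofEquiv finAddFlip

/-- A family of caps: in the target, `i` is joined with `n + i` for `i < n`. -/
def caps (n : ℕ) : Br.mk 0 ⟶ Br.mk (n + n) :=
  (BrRel.cap (Fin 0) (Fin n)).reindex (Equiv.refl _) finSumFinEquiv

/-- A family of cups: in the source, `i` is joined with `n + i` for `i < n`. -/
def cups (n : ℕ) : Br.mk (n + n) ⟶ Br.mk 0 :=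
  (BrRel.cup (Fin n) (Fin 0)).reindex finSumFinEquiv (Equiv.refl _)

/-- The diagram of transitivity: in the source blocks `k, l, l, m`, the two middle ones are
joined by cups, the outer ones are joined with the blocks `k, m` of the target. -/
def transDiagram (k l m : ℕ) : Br.mk ((k + l) + (l + m)) ⟶ Br.mk (k + m) :=
  lines (by omega : (k + l) + (l + m) = k + ((l + l) + m)) ≫
    tensor (𝟙 (Br.mk k)) (tensor (cups l) (𝟙 (Br.mk m))) ≫
      lines (by omega : k + (0 + m) = k + m)

/-- Four blocks of parallel lines, the two middle blocks crossing each other. -/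
def middleCross (k l m n : ℕ) : Br.mk ((k + l) + (m + n)) ⟶ Br.mk ((k + m) + (l + n)) :=
  lines (by omega : (k + l) + (m + n) = k + ((l + m) + n)) ≫
    tensor (𝟙 (Br.mk k)) (tensor (cross l m) (𝟙 (Br.mk n))) ≫
      lines (by omega : k + ((m + l) + n) = (k + m) + (l + n))

/-! Auxiliary facts for computing with arrows of Br. -/

section inv

/-- Restriction to the first block. -/
def fst {m n : ℕ} (p : Fin (m + n) → Prop) : Fin m → Prop := fun i => p (Fin.castAdd n i)

/-- Restriction to the second block. -/
def snd {m n : ℕ} (p : Fin (m + n) → Prop) : Fin n → Prop := fun i => p (Fin.natAdd m i)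

theorem fst_append {m n : ℕ} (p : Fin m → Prop) (q : Fin n → Prop) :
    fst (Fin.append p q) = p := funext fun i => Fin.append_left p q i

theorem snd_append {m n : ℕ} (p : Fin m → Prop) (q : Fin n → Prop) :
    snd (Fin.append p q) = q := funext fun i => Fin.append_right p q i

theorem split_ext {m n : ℕ} {p q : Fin (m + n) → Prop} :
    p = q ↔ fst p = fst q ∧ snd p = snd q := by
  constructor
  · rintro rfl; exact ⟨rfl, rfl⟩
  · rintro ⟨h1, h2⟩
    funext i
    induction i using Fin.addCases with
    | left i => exact congrFun h1 i
    | right i => exact congrFun h2 i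

theorem exists_split {m n : ℕ} {P : (Fin (m + n) → Prop) → Prop} :
    (∃ p, P p) ↔ ∃ p q, P (Fin.append p q) := by
  constructor
  · rintro ⟨p, hp⟩
    refine ⟨fst p, snd p, ?_⟩
    convert hp
    exact split_ext.2 ⟨fst_append _ _, snd_append _ _⟩
  · rintro ⟨p, q, h⟩; exact ⟨_, h⟩

/-- The predicates `p` on the source and `q` on the target are constant on the classes of `f`. -/
def Sat {m n : ℕ} (f : Br.mk m ⟶ Br.mk n) (p : Fin m → Prop) (q : Fin n → Prop) : Prop :=
  BrRel.Inv f p q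

theorem ext_sat {m n : ℕ} {f g : Br.mk m ⟶ Br.mk n} (h : ∀ p q, Sat f p q ↔ Sat g p q) : f = g :=
  BrRel.ext_inv h

theorem inv_id {m : ℕ} (p q : Fin m → Prop) : Sat (𝟙 (Br.mk m)) p q ↔ p = q :=
  (BrRel.inv_ofEquiv _ _ _).trans funext_iff.symm

theorem inv_comp {k m n : ℕ} (f : Br.mk k ⟶ Br.mk m) (g : Br.mk m ⟶ Br.mk n)
    (p : Fin k → Prop) (q : Fin n → Prop) :
    Sat (f ≫ g) p q ↔ ∃ s : Fin m → Prop, Sat f p s ∧ Sat g s q :=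
  BrRel.inv_comp f g p q

theorem inv_tensor {m n m' n' : ℕ} (f : Br.mk m ⟶ Br.mk n) (g : Br.mk m' ⟶ Br.mk n')
    (p : Fin (m + m') → Prop) (q : Fin (n + n') → Prop) :
    Sat (tensor f g) p q ↔ Sat f (fst p) (fst q) ∧ Sat g (snd p) (snd q) := by
  unfold Sat tensor
  rw [BrRel.inv_reindex, BrRel.inv_tensor]
  rfl

theorem inv_lines {m n : ℕ} (h : m = n) (p : Fin m → Prop) (q : Fin n → Prop) :
    Sat (lines h) p q ↔ p = fun i => q (i.cast h) :=
  (BrRel.inv_ofEquiv _ _ _).trans funext_iff.symm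

theorem inv_cross (m n : ℕ) (p : Fin (m + n) → Prop) (q : Fin (n + m) → Prop) :
    Sat (cross m n) p q ↔ fst p = snd q ∧ snd p = fst q := by
  refine (BrRel.inv_ofEquiv _ _ _).trans ?_
  rw [← funext_iff (f := p) (g := fun a => q (finAddFlip a)), split_ext]
  have h1 : fst (fun a => q (finAddFlip a)) = snd q := by
    funext i; simp [fst, snd]
  have h2 : snd (fun a => q (finAddFlip a)) = fst q := by
    funext i; simp [fst, snd]
  rw [h1, h2]

theorem inv_caps (n : ℕ) (p : Fin 0 → Prop) (q : Fin (n + n) → Prop) :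
    Sat (caps n) p q ↔ fst q = snd q := by
  unfold Sat caps
  rw [BrRel.inv_reindex, BrRel.inv_cap]
  exact funext_iff.symm

theorem inv_cups (n : ℕ) (p : Fin (n + n) → Prop) (q : Fin 0 → Prop) :
    Sat (cups n) p q ↔ fst p = snd p := by
  unfold Sat cups
  rw [BrRel.inv_reindex, BrRel.inv_cup]
  exact funext_iff.symm

theorem zero_ext {p q : Fin 0 → Prop} : p = q ↔ True := by simp [Subsingleton.elim p q]

theorem exists_zero {P : (Fin 0 → Prop) → Prop} : (∃ p, P p) ↔ P Fin.elim0 := by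
  constructor
  · rintro ⟨p, hp⟩; rwa [Subsingleton.elim p Fin.elim0] at hp
  · exact fun h => ⟨_, h⟩

theorem inv_assoc (k m n : ℕ) (h : k + (m + n) = k + m + n) (p q) :
    Sat (lines h) p q ↔
      fst p = fst (fst q) ∧ fst (snd p) = snd (fst q) ∧ snd (snd p) = snd q := by
  rw [inv_lines, split_ext, split_ext (p := snd p)]
  have h1 : (fst fun i => q (i.cast h)) = fst (fst q) := rfl
  have h2 : fst (snd fun i => q (i.cast h)) = snd (fst q) := rfl
  have h3 : snd (snd fun i => q (i.cast h)) = snd q := by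
    funext i
    show q _ = q _
    congr 1
    ext
    simp [add_assoc]
  rw [h1, h2, h3]

theorem inv_assoc_symm (k m n : ℕ) (h : k + m + n = k + (m + n)) (p q) :
    Sat (lines h) p q ↔
      fst (fst p) = fst q ∧ snd (fst p) = fst (snd q) ∧ snd p = snd (snd q) := by
  rw [inv_lines, split_ext, split_ext (p := fst p), and_assoc]
  have h1 : fst (fst fun i => q (i.cast h)) = fst q := rfl
  have h2 : snd (fst fun i => q (i.cast h)) = fst (snd q) := rfl
  have h3 : snd (fun i => q (i.cast h)) = snd (snd q) := by
    funext i
    show q _ = q _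
    congr 1
    ext
    simp [add_assoc]
  rw [h1, h2, h3]

theorem inv_delta (n : ℕ) (h : n + 0 = n) (p : Fin (n + 0) → Prop) (q) :
    Sat (lines h) p q ↔ fst p = q := Iff.rfl.trans (inv_lines h p q)

theorem inv_delta_symm (n : ℕ) (h : n = n + 0) (p) (q : Fin (n + 0) → Prop) :
    Sat (lines h) p q ↔ p = fst q := Iff.rfl.trans (inv_lines h p q)

theorem inv_sigma (n : ℕ) (h : 0 + n = n) (p : Fin (0 + n) → Prop) (q) :
    Sat (lines h) p q ↔ snd p = q := by
  rw [inv_lines, split_ext, zero_ext, true_and]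
  have h3 : snd (fun i => q (i.cast h)) = q := by
    funext i
    show q _ = q _
    congr 1
    ext
    simp
  rw [h3]

theorem inv_sigma_symm (n : ℕ) (h : n = 0 + n) (p) (q : Fin (0 + n) → Prop) :
    Sat (lines h) p q ↔ p = snd q := by
  rw [inv_lines]
  have h3 : (fun i => q (i.cast h)) = snd q := by
    funext i
    show q _ = q _
    congr 1
    ext
    simp
  rw [h3]

theorem inv_four (k l m n : ℕ) (h : (k + l) + (m + n) = k + ((l + m) + n)) (p q) :
    Sat (lines h) p q ↔ fst (fst p) = fst q ∧ snd (fst p) = fst (fst (snd q)) ∧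
      fst (snd p) = snd (fst (snd q)) ∧ snd (snd p) = snd (snd q) := by
  rw [inv_lines, split_ext, split_ext (p := fst p), split_ext (p := snd p), and_assoc]
  have h1 : fst (fst fun i => q (i.cast h)) = fst q := rfl
  have h2 : snd (fst fun i => q (i.cast h)) = fst (fst (snd q)) := rfl
  have h3 : fst (snd fun i => q (i.cast h)) = snd (fst (snd q)) := by
    funext i
    show q _ = q _
    congr 1
    ext
    simp [add_assoc]
  have h4 : snd (snd fun i => q (i.cast h)) = snd (snd q) := by
    funext i
    show q _ = q _
    congr 1
    ext
    simp [add_assoc]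
  rw [h1, h2, h3, h4]

theorem inv_four_symm (k l m n : ℕ) (h : k + ((l + m) + n) = (k + l) + (m + n)) (p q) :
    Sat (lines h) p q ↔ fst p = fst (fst q) ∧ fst (fst (snd p)) = snd (fst q) ∧
      snd (fst (snd p)) = fst (snd q) ∧ snd (snd p) = snd (snd q) := by
  have key : Sat (lines h) p q ↔ Sat (lines h.symm) q p := by
    rw [inv_lines, inv_lines]
    constructor
    · rintro rfl; rfl
    · rintro rfl; rfl
  rw [key, inv_four]
  simp only [eq_comm]

theorem inv_transDiagram (k l m : ℕ) (p q) :
    Sat (transDiagram k l m) p q ↔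
      fst (fst p) = fst q ∧ snd (fst p) = fst (snd p) ∧ snd (snd p) = snd q := by
  have e : Sat (lines (by omega : k + (0 + m) = k + m)) =
      fun p q => fst p = fst q ∧ snd (snd p) = snd q := by
    funext p q
    rw [inv_lines, split_ext, split_ext (p := snd p), zero_ext, true_and]
    have h1 : (fst fun i => q (i.cast (by omega : k + (0 + m) = k + m))) = fst q := rfl
    have h3 : snd (snd fun i => q (i.cast (by omega : k + (0 + m) = k + m))) = snd q := by
      funext i
      show q _ = q _
      congr 1
      ext
      simp
    rw [h1, h3]
  unfold transDiagram
  rw [inv_comp]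
  simp only [inv_comp, inv_four, inv_tensor, inv_id, inv_cups, e, exists_split, exists_zero,
    fst_append, snd_append]
  constructor
  · rintro ⟨p1, p2, p3, p4, ⟨rfl, rfl, rfl, rfl⟩, q1, q4, ⟨h1, h2, h3⟩, h4, h5⟩
    exact ⟨h1.trans h4, h2, h3.trans h5⟩
  · rintro ⟨h1, h2, h3⟩
    exact ⟨_, _, _, _, ⟨rfl, rfl, rfl, rfl⟩, _, _, ⟨rfl, h2, rfl⟩, h1, h3⟩

theorem inv_middleCross (k l m n : ℕ) (p q) :
    Sat (middleCross k l m n) p q ↔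
      fst (fst p) = fst (fst q) ∧ snd (fst p) = fst (snd q) ∧
        fst (snd p) = snd (fst q) ∧ snd (snd p) = snd (snd q) := by
  unfold middleCross
  rw [inv_comp]
  simp only [inv_comp, inv_four, inv_four_symm, inv_tensor, inv_id, inv_cross, exists_split,
    fst_append, snd_append]
  constructor
  · rintro ⟨p1, p2, p3, p4, ⟨rfl, rfl, rfl, rfl⟩, q1, q2, q3, q4, ⟨rfl, ⟨rfl, rfl⟩, rfl⟩,
      h1, h2, h3, h4⟩
    exact ⟨h1, h3, h2, h4⟩
  · rintro ⟨h1, h2, h3, h4⟩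
    exact ⟨_, _, _, _, ⟨rfl, rfl, rfl, rfl⟩, _, _, _, _, ⟨rfl, ⟨rfl, rfl⟩, rfl⟩, h1, h3, h2, h4⟩

end inv

end Br

/-! ## The syntactical category -/

/-- Terms, built from the variables in `V` with a binary operation. -/
inductive SDotTerm (V : Type u) : Type u
  | var : V → SDotTerm V
  | op : SDotTerm V → SDotTerm V → SDotTerm V

/-- The number of occurrences of variables in a term. -/
def SDotTerm.occ {V : Type u} : SDotTerm V → ℕ
  | var _ => 1
  | op t s => t.occ + s.occ

/-- Formulae: `t ≤ s`, `⊤` and conjunctions. -/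
inductive SDot (V : Type u) : Type u
  | le : SDotTerm V → SDotTerm V → SDot V
  | top : SDot V
  | and : SDot V → SDot V → SDot V

namespace SDot

variable {V : Type u}

/-- The number of occurrences of variables in a formula. -/
def occ : SDot V → ℕ
  | le t s => t.occ + s.occ
  | top => 0
  | and A B => A.occ + B.occ

/-- Arrow terms `f : A ⊢ B`. In `comp g f` the arrow term `f` is applied first. -/
inductive ArrowTerm : SDot V → SDot V → Type u
  | one (A : SDot V) : ArrowTerm A A
  | bTo (A B C : SDot V) : ArrowTerm (and A (and B C)) (and (and A B) C)
  | bFrom (A B C : SDot V) : ArrowTerm (and (and A B) C) (and A (and B C))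
  | deltaTo (A : SDot V) : ArrowTerm (and A top) A
  | deltaFrom (A : SDot V) : ArrowTerm A (and A top)
  | sigmaTo (A : SDot V) : ArrowTerm (and top A) A
  | sigmaFrom (A : SDot V) : ArrowTerm A (and top A)
  | c (A B : SDot V) : ArrowTerm (and A B) (and B A)
  | r (t : SDotTerm V) : ArrowTerm top (le t t)
  | t (x y z : SDotTerm V) : ArrowTerm (and (le x y) (le y z)) (le x z)
  | a (t₁ t₂ t₃ t₄ : SDotTerm V) :
      ArrowTerm (and (le t₁ t₂) (le t₃ t₄)) (le (.op t₁ t₃) (.op t₂ t₄))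
  | wedge {A B C D : SDot V} : ArrowTerm A B → ArrowTerm C D → ArrowTerm (and A C) (and B D)
  | comp {A B C : SDot V} : ArrowTerm B C → ArrowTerm A B → ArrowTerm A C

namespace ArrowTerm

/-- The arrow term exchanging the two inner conjuncts. -/
def cm (A B C D : SDot V) : ArrowTerm (and (and A B) (and C D)) (and (and A C) (and B D)) :=
  comp (bTo A C (and B D))
    (comp (wedge (one A) (comp (bFrom C B D) (comp (wedge (c B C) (one D)) (bTo B C D))))
      (bFrom A B (and C D)))

/-- The smallest equivalence relation on arrow terms, congruent for `∧` and composition, that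
satisfies the equations of the category. -/
inductive Equal : {A B : SDot V} → ArrowTerm A B → ArrowTerm A B → Prop
  | refl {A B : SDot V} (f : ArrowTerm A B) : Equal f f
  | symm {A B : SDot V} {f g : ArrowTerm A B} : Equal f g → Equal g f
  | trans {A B : SDot V} {f g h : ArrowTerm A B} : Equal f g → Equal g h → Equal f h
  | wedge_congr {A B C D : SDot V} {f₁ g₁ : ArrowTerm A B} {f₂ g₂ : ArrowTerm C D} :
      Equal f₁ g₁ → Equal f₂ g₂ → Equal (wedge f₁ f₂) (wedge g₁ g₂)
  | comp_congr {A B C : SDot V} {f₁ g₁ : ArrowTerm A B} {f₂ g₂ : ArrowTerm B C} :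
      Equal f₁ g₁ → Equal f₂ g₂ → Equal (comp f₂ f₁) (comp g₂ g₁)
  -- categorial equations
  | one_comp {A B : SDot V} (f : ArrowTerm A B) : Equal (comp (one B) f) f
  | comp_one {A B : SDot V} (f : ArrowTerm A B) : Equal (comp f (one A)) f
  | comp_assoc {A B C D : SDot V} (h : ArrowTerm C D) (g : ArrowTerm B C) (f : ArrowTerm A B) :
      Equal (comp (comp h g) f) (comp h (comp g f))
  -- bifunctoriality equations
  | wedge_one (A B : SDot V) : Equal (wedge (one A) (one B)) (one (and A B))
  | wedge_comp {A₁ B₁ C₁ A₂ B₂ C₂ : SDot V} (g₁ : ArrowTerm B₁ C₁) (f₁ : ArrowTerm A₁ B₁)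
      (g₂ : ArrowTerm B₂ C₂) (f₂ : ArrowTerm A₂ B₂) :
      Equal (wedge (comp g₁ f₁) (comp g₂ f₂)) (comp (wedge g₁ g₂) (wedge f₁ f₂))
  -- naturality equations
  | b_nat {A B C D E F : SDot V} (f : ArrowTerm A D) (g : ArrowTerm B E) (h : ArrowTerm C F) :
      Equal (comp (wedge (wedge f g) h) (bTo A B C)) (comp (bTo D E F) (wedge f (wedge g h)))
  | delta_nat {A D : SDot V} (f : ArrowTerm A D) :
      Equal (comp f (deltaTo A)) (comp (deltaTo D) (wedge f (one top)))
  | sigma_nat {A D : SDot V} (f : ArrowTerm A D) :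
      Equal (comp f (sigmaTo A)) (comp (sigmaTo D) (wedge (one top) f))
  | c_nat {A B D E : SDot V} (f : ArrowTerm A D) (g : ArrowTerm B E) :
      Equal (comp (wedge g f) (c A B)) (comp (c D E) (wedge f g))
  -- specific equations of symmetric monoidal categories
  | bFrom_bTo (A B C : SDot V) : Equal (comp (bFrom A B C) (bTo A B C)) (one _)
  | bTo_bFrom (A B C : SDot V) : Equal (comp (bTo A B C) (bFrom A B C)) (one _)
  | b_five (A B C D : SDot V) :
      Equal (comp (bTo (and A B) C D) (bTo A B (and C D)))
        (comp (wedge (bTo A B C) (one D))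
          (comp (bTo A (and B C) D) (wedge (one A) (bTo B C D))))
  | deltaFrom_deltaTo (A : SDot V) : Equal (comp (deltaFrom A) (deltaTo A)) (one _)
  | deltaTo_deltaFrom (A : SDot V) : Equal (comp (deltaTo A) (deltaFrom A)) (one A)
  | sigmaFrom_sigmaTo (A : SDot V) : Equal (comp (sigmaFrom A) (sigmaTo A)) (one _)
  | sigmaTo_sigmaFrom (A : SDot V) : Equal (comp (sigmaTo A) (sigmaFrom A)) (one A)
  | b_delta_sigma (A C : SDot V) :
      Equal (bTo A top C) (comp (wedge (deltaFrom A) (one C)) (wedge (one A) (sigmaTo C)))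
  | c_c (A B : SDot V) : Equal (comp (c B A) (c A B)) (one (and A B))
  | b_c (A B C : SDot V) :
      Equal (c A (and B C))
        (comp (bTo B C A) (comp (wedge (one B) (c A C))
          (comp (bFrom B A C) (comp (wedge (c A B) (one C)) (bTo A B C)))))
  -- reflexivity and transitivity
  | r_t_delta (x y : SDotTerm V) :
      Equal (comp (t x y y) (wedge (one (le x y)) (r y))) (deltaTo (le x y))
  | r_t_sigma (x y : SDotTerm V) :
      Equal (comp (t y y x) (wedge (r y) (one (le y x)))) (sigmaTo (le y x))
  | t_b (x y z w : SDotTerm V) :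
      Equal (comp (t x y w) (wedge (one (le x y)) (t y z w)))
        (comp (t x z w) (comp (wedge (t x y z) (one (le z w)))
          (bTo (le x y) (le y z) (le z w))))
  -- compatibility of the operation with reflexivity and transitivity
  | r_a (x y : SDotTerm V) :
      Equal (comp (a x x y y) (comp (wedge (r x) (r y)) (deltaFrom top))) (r (.op x y))
  | t_a (t₁ s₁ r₁ t₂ s₂ r₂ : SDotTerm V) :
      Equal (comp (a t₁ r₁ t₂ r₂) (wedge (t t₁ s₁ r₁) (t t₂ s₂ r₂)))
        (comp (t (.op t₁ t₂) (.op s₁ s₂) (.op r₁ r₂))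
          (comp (wedge (a t₁ s₁ t₂ s₂) (a s₁ r₁ s₂ r₂))
            (cm (le t₁ s₁) (le s₁ r₁) (le t₂ s₂) (le s₂ r₂))))

/-- Equality of arrow terms as a setoid. -/
def setoid (A B : SDot V) : Setoid (ArrowTerm A B) :=
  ⟨Equal, ⟨Equal.refl, Equal.symm, Equal.trans⟩⟩

/-- The diagram of an arrow term. -/
def diagram : {A B : SDot V} → ArrowTerm A B → (Br.mk A.occ ⟶ Br.mk B.occ)
  | _, _, one A => 𝟙 (Br.mk A.occ)
  | _, _, bTo A B C => Br.lines (Nat.add_assoc A.occ B.occ C.occ).symm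
  | _, _, bFrom A B C => Br.lines (Nat.add_assoc A.occ B.occ C.occ)
  | _, _, deltaTo A => Br.lines (Nat.add_zero A.occ)
  | _, _, deltaFrom A => Br.lines (Nat.add_zero A.occ).symm
  | _, _, sigmaTo A => Br.lines (Nat.zero_add A.occ)
  | _, _, sigmaFrom A => Br.lines (Nat.zero_add A.occ).symm
  | _, _, c A B => Br.cross A.occ B.occ
  | _, _, r x => Br.caps x.occ
  | _, _, t x y z => Br.transDiagram x.occ y.occ z.occ
  | _, _, a t₁ t₂ t₃ t₄ => Br.middleCross t₁.occ t₂.occ t₃.occ t₄.occ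
  | _, _, wedge f g => Br.tensor f.diagram g.diagram
  | _, _, comp g f => f.diagram ≫ g.diagram

/-! Auxiliary facts showing that the diagram of an arrow term respects equality. -/

section soundness

/-- Predicates on the occurrences of variables in a formula. -/
abbrev Col (A : SDot V) : Type := Fin A.occ → Prop

/-- Predicates on the occurrences of variables in a term. -/
abbrev TCol (x : SDotTerm V) : Type := Fin x.occ → Prop

def andFst {A B : SDot V} (p : Col (and A B)) : Col A := Br.fst (m := A.occ) (n := B.occ) p
def andSnd {A B : SDot V} (p : Col (and A B)) : Col B := Br.snd (m := A.occ) (n := B.occ) p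
def leFst {x y : SDotTerm V} (p : Col (le x y)) : TCol x := Br.fst (m := x.occ) (n := y.occ) p
def leSnd {x y : SDotTerm V} (p : Col (le x y)) : TCol y := Br.snd (m := x.occ) (n := y.occ) p
def opFst {x y : SDotTerm V} (p : TCol (.op x y)) : TCol x := Br.fst (m := x.occ) (n := y.occ) p
def opSnd {x y : SDotTerm V} (p : TCol (.op x y)) : TCol y := Br.snd (m := x.occ) (n := y.occ) p

def mkAnd {A B : SDot V} (p : Col A) (q : Col B) : Col (and A B) :=
  Fin.append (m := A.occ) (n := B.occ) p q
def mkLe {x y : SDotTerm V} (p : TCol x) (q : TCol y) : Col (le x y) :=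
  Fin.append (m := x.occ) (n := y.occ) p q
def mkOp {x y : SDotTerm V} (p : TCol x) (q : TCol y) : TCol (.op x y) :=
  Fin.append (m := x.occ) (n := y.occ) p q

variable {A B C D : SDot V} {x y z w : SDotTerm V}

theorem andFst_mk (p : Col A) (q : Col B) : andFst (mkAnd p q) = p := Br.fst_append _ _
theorem andSnd_mk (p : Col A) (q : Col B) : andSnd (mkAnd p q) = q := Br.snd_append _ _
theorem leFst_mk (p : TCol x) (q : TCol y) : leFst (mkLe p q) = p := Br.fst_append _ _
theorem leSnd_mk (p : TCol x) (q : TCol y) : leSnd (mkLe p q) = q := Br.snd_append _ _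
theorem opFst_mk (p : TCol x) (q : TCol y) : opFst (mkOp p q) = p := Br.fst_append _ _
theorem opSnd_mk (p : TCol x) (q : TCol y) : opSnd (mkOp p q) = q := Br.snd_append _ _

theorem and_ext {p q : Col (and A B)} : p = q ↔ andFst p = andFst q ∧ andSnd p = andSnd q :=
  Br.split_ext (m := A.occ) (n := B.occ)
theorem le_ext {p q : Col (le x y)} : p = q ↔ leFst p = leFst q ∧ leSnd p = leSnd q :=
  Br.split_ext (m := x.occ) (n := y.occ)
theorem op_ext {p q : TCol (.op x y)} : p = q ↔ opFst p = opFst q ∧ opSnd p = opSnd q :=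
  Br.split_ext (m := x.occ) (n := y.occ)
theorem top_ext {p q : Col (top : SDot V)} : p = q ↔ True := Br.zero_ext

theorem exists_and {P : Col (and A B) → Prop} : (∃ p, P p) ↔ ∃ p q, P (mkAnd p q) :=
  Br.exists_split (m := A.occ) (n := B.occ)
theorem exists_le {P : Col (le x y) → Prop} : (∃ p, P p) ↔ ∃ p q, P (mkLe p q) :=
  Br.exists_split (m := x.occ) (n := y.occ)
theorem exists_op {P : TCol (.op x y) → Prop} : (∃ p, P p) ↔ ∃ p q, P (mkOp p q) :=
  Br.exists_split (m := x.occ) (n := y.occ)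
theorem exists_top {P : Col (top : SDot V) → Prop} : (∃ p, P p) ↔ P Fin.elim0 := Br.exists_zero

/-- The predicates `p` and `q` are constant on the classes of the diagram of `f`. -/
def Sat (f : ArrowTerm A B) (p : Col A) (q : Col B) : Prop := Br.Sat f.diagram p q

theorem sat_one (p q : Col A) : Sat (one A) p q ↔ p = q := Br.inv_id p q
theorem sat_comp (g : ArrowTerm B C) (f : ArrowTerm A B) (p q) :
    Sat (comp g f) p q ↔ ∃ s, Sat f p s ∧ Sat g s q := Br.inv_comp _ _ p q
theorem sat_wedge (f : ArrowTerm A B) (g : ArrowTerm C D) (p q) :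
    Sat (wedge f g) p q ↔ Sat f (andFst p) (andFst q) ∧ Sat g (andSnd p) (andSnd q) :=
  Br.inv_tensor _ _ p q
theorem sat_bTo (p q) : Sat (bTo A B C) p q ↔ andFst p = andFst (andFst q) ∧
    andFst (andSnd p) = andSnd (andFst q) ∧ andSnd (andSnd p) = andSnd q :=
  Br.inv_assoc _ _ _ _ p q
theorem sat_bFrom (p q) : Sat (bFrom A B C) p q ↔ andFst (andFst p) = andFst q ∧
    andSnd (andFst p) = andFst (andSnd q) ∧ andSnd p = andSnd (andSnd q) :=
  Br.inv_assoc_symm _ _ _ _ p q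
theorem sat_deltaTo (p q) : Sat (deltaTo A) p q ↔ andFst p = q := Br.inv_delta _ _ p q
theorem sat_deltaFrom (p q) : Sat (deltaFrom A) p q ↔ p = andFst q := Br.inv_delta_symm _ _ p q
theorem sat_sigmaTo (p q) : Sat (sigmaTo A) p q ↔ andSnd p = q := Br.inv_sigma _ _ p q
theorem sat_sigmaFrom (p q) : Sat (sigmaFrom A) p q ↔ p = andSnd q := Br.inv_sigma_symm _ _ p q
theorem sat_c (p q) : Sat (c A B) p q ↔ andFst p = andSnd q ∧ andSnd p = andFst q :=
  Br.inv_cross _ _ p q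
theorem sat_r (p q) : Sat (r x) p q ↔ leFst q = leSnd q := Br.inv_caps _ p q
theorem sat_t (p q) : Sat (t x y z) p q ↔ leFst (andFst p) = leFst q ∧
    leSnd (andFst p) = leFst (andSnd p) ∧ leSnd (andSnd p) = leSnd q :=
  Br.inv_transDiagram _ _ _ p q
theorem sat_a (p q) : Sat (a x y z w) p q ↔ leFst (andFst p) = opFst (leFst q) ∧
    leSnd (andFst p) = opFst (leSnd q) ∧ leFst (andSnd p) = opSnd (leFst q) ∧
      leSnd (andSnd p) = opSnd (leSnd q) :=
  Br.inv_middleCross _ _ _ _ p q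

/-- Equal arrow terms have the same diagram. -/
theorem diagram_eq_of_equal {A B : SDot V} {f g : ArrowTerm A B} (h : Equal f g) :
    f.diagram = g.diagram := by
  induction h with
  | refl => rfl
  | symm _ ih => exact ih.symm
  | trans _ _ ih1 ih2 => exact ih1.trans ih2
  | wedge_congr _ _ ih1 ih2 => unfold diagram; rw [ih1, ih2]
  | comp_congr _ _ ih1 ih2 => unfold diagram; rw [ih1, ih2]
  | one_comp f => exact Category.comp_id _
  | comp_one f => exact Category.id_comp _
  | comp_assoc h g f => exact (Category.assoc _ _ _).symm
  | _ =>
    refine Br.ext_sat fun p q => ?_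
    change Sat _ p q ↔ Sat _ p q
    simp only [cm, sat_one, sat_comp, sat_wedge, sat_bTo, sat_bFrom, sat_deltaTo, sat_deltaFrom,
      sat_sigmaTo, sat_sigmaFrom, sat_c, sat_r, sat_t, sat_a, exists_and, exists_le, exists_op, exists_top,
      andFst_mk, andSnd_mk, leFst_mk, leSnd_mk, opFst_mk, opSnd_mk, and_ext, le_ext,
      op_ext, top_ext]
    first | done | grind

end soundness

end ArrowTerm

/-- The objects are formulae; the arrows are equivalence classes of arrow terms. -/
instance : Category.{u} (SDot V) where
  Hom A B := Quotient (ArrowTerm.setoid A B)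
  id A := Quotient.mk _ (ArrowTerm.one A)
  comp f g := Quotient.map₂ (fun f g => ArrowTerm.comp g f)
    (fun _ _ h₁ _ _ h₂ => ArrowTerm.Equal.comp_congr h₁ h₂) f g
  id_comp f := Quotient.inductionOn f fun f => Quotient.sound (ArrowTerm.Equal.comp_one f)
  comp_id f := Quotient.inductionOn f fun f => Quotient.sound (ArrowTerm.Equal.one_comp f)
  assoc f g h := Quotient.inductionOn₃ f g h fun f g h =>
    Quotient.sound (ArrowTerm.Equal.symm (ArrowTerm.Equal.comp_assoc h g f))

/-- The functor sending a formula to its number of occurrences of variables and an arrow to the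
diagram of any arrow term that represents it. -/
def G (V : Type u) : SDot V ⥤ Br where
  obj A := Br.mk A.occ
  map f := Quotient.lift ArrowTerm.diagram (fun _ _ h => ArrowTerm.diagram_eq_of_equal h) f
  map_id _ := rfl
  map_comp f g := Quotient.inductionOn₂ f g fun _ _ => rfl

end SDot

/-! Diagrams are compared through colourings. A split equivalence is determined by the pairs of
predicates on source and target occurrences that are constant on its classes (`SatG`), and these
pairs compose like relations. Equality of diagrams thus becomes equivalence of relations that can be
computed constructor by constructor.

The normal form comes from reading an atom `u ≤ v` as a rewriting step. By means of `r`, `a` and `t`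
it acts on a formula `Z`: an occurrence of `u` in the right-hand side of some atom of `Z` is
replaced by `v`. A run `Z ⊗ A ⟶ B` uses each atom of `A` exactly once in this way and turns `Z` into
`B`. Let `base B` be `B` with every atom `x ≤ y` replaced by `x ≤ x`. There is a run `k : base B ⊗ B
⟶ B` which becomes the identity of `B` once `base B` is supplied by reflexivities (`exists_run_id`).
Hence `f : A ⟶ B` is recovered from `base B ◁ f ≫ k`.

Runs absorb arbitrary arrows on the side of `A` (`Run.comp`). Structural arrows only relocate the
atoms to be used. If an atom used by a step is produced by `r`, the step disappears. If it is
produced by `t`, the step becomes two successive replacements of the same occurrence. If it is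
produced by `a`, the step becomes replacements of the two immediate subterms. These are the
equations relating `r`, `t` and `a`, carried through contexts of operations and conjunctions.

Finally, runs `Z ⊗ A ⟶ B` with the same diagram are equal (`Run.eq_of_satG`). The first step of one
run links an occurrence in `Z` with the left-hand side of an atom of `A`. In the other run the same
atom is used at some stage, and the link forces it to be used at that occurrence. The earlier steps
act on disjoint occurrences, so they commute with this one, which can be brought to the front
(`Run.exists_step`). It is then cancelled from both runs, and induction applies.

The bookkeeping rests on coherence of the structural arrows alone (`Str.eq_of_satG`), proved by
extracting the atoms of the target one at a time. -/

open CategoryTheory MonoidalCategory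

namespace SDot

variable {V : Type u}

/-! ## The symmetric monoidal structure -/

/-- The arrow represented by an arrow term. -/
def hom {A B : SDot V} (f : ArrowTerm A B) : A ⟶ B := Quotient.mk (ArrowTerm.setoid A B) f

theorem hom_eq {A B : SDot V} {f g : ArrowTerm A B} (h : ArrowTerm.Equal f g) : hom f = hom g :=
  Quotient.sound h

theorem exists_hom {A B : SDot V} (f : A ⟶ B) : ∃ t : ArrowTerm A B, hom t = f :=
  Quotient.exists_rep f

/-- The conjunction of two arrows. -/
def wedgeHom {A B C D : SDot V} (f : A ⟶ B) (g : C ⟶ D) : and A C ⟶ and B D :=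
  Quotient.map₂ ArrowTerm.wedge (fun _ _ h₁ _ _ h₂ => ArrowTerm.Equal.wedge_congr h₁ h₂) f g

instance : MonoidalCategoryStruct (SDot V) where
  tensorObj := and
  whiskerLeft X _ _ f := wedgeHom (𝟙 X) f
  whiskerRight f Y := wedgeHom f (𝟙 Y)
  tensorHom := wedgeHom
  tensorUnit := top
  associator A B C :=
    ⟨hom (.bFrom A B C), hom (.bTo A B C), hom_eq (.bTo_bFrom A B C), hom_eq (.bFrom_bTo A B C)⟩
  leftUnitor A :=
    ⟨hom (.sigmaTo A), hom (.sigmaFrom A), hom_eq (.sigmaFrom_sigmaTo A),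
      hom_eq (.sigmaTo_sigmaFrom A)⟩
  rightUnitor A :=
    ⟨hom (.deltaTo A), hom (.deltaFrom A), hom_eq (.deltaFrom_deltaTo A),
      hom_eq (.deltaTo_deltaFrom A)⟩

theorem hom_wedge {A B C D : SDot V} (f : ArrowTerm A B) (g : ArrowTerm C D) :
    hom (f.wedge g) = hom f ⊗ₘ hom g := rfl

theorem wedgeHom_comp {A₁ B₁ C₁ A₂ B₂ C₂ : SDot V} (f₁ : A₁ ⟶ B₁) (g₁ : B₁ ⟶ C₁)
    (f₂ : A₂ ⟶ B₂) (g₂ : B₂ ⟶ C₂) :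
    wedgeHom (f₁ ≫ g₁) (f₂ ≫ g₂) = wedgeHom f₁ f₂ ≫ wedgeHom g₁ g₂ := by
  obtain ⟨f₁, rfl⟩ := exists_hom f₁
  obtain ⟨f₂, rfl⟩ := exists_hom f₂
  obtain ⟨g₁, rfl⟩ := exists_hom g₁
  obtain ⟨g₂, rfl⟩ := exists_hom g₂
  exact hom_eq (.wedge_comp g₁ f₁ g₂ f₂)

theorem assoc_natural {A B C D E F : SDot V} (f : A ⟶ D) (g : B ⟶ E) (h : C ⟶ F) :
    wedgeHom (wedgeHom f g) h ≫ (α_ D E F).hom = (α_ A B C).hom ≫ wedgeHom f (wedgeHom g h) := by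
  obtain ⟨f, rfl⟩ := exists_hom f
  obtain ⟨g, rfl⟩ := exists_hom g
  obtain ⟨h, rfl⟩ := exists_hom h
  rw [← Iso.eq_comp_inv, Category.assoc, ← Iso.inv_comp_eq]
  exact hom_eq (.b_nat f g h)

instance : MonoidalCategory (SDot V) := MonoidalCategory.ofTensorHom
  (id_tensorHom_id := fun A B => hom_eq (.wedge_one A B))
  (tensorHom_comp_tensorHom := fun f₁ f₂ g₁ g₂ => (wedgeHom_comp f₁ g₁ f₂ g₂).symm)
  (associator_naturality := fun f g h => assoc_natural f g h)
  (leftUnitor_naturality := fun f => by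
    obtain ⟨f, rfl⟩ := exists_hom f
    exact (hom_eq (.sigma_nat f)).symm)
  (rightUnitor_naturality := fun f => by
    obtain ⟨f, rfl⟩ := exists_hom f
    exact (hom_eq (.delta_nat f)).symm)
  (pentagon := fun A B C D => by
    -- `b_five` is a pentagon of inverse associators. It is turned into the usual one by composing
    -- with inverses on the right.
    have h : (α_ A B (C ⊗ D)).inv ≫ (α_ (A ⊗ B) C D).inv =
        (wedgeHom (𝟙 A) (α_ B C D).inv ≫ (α_ A (B ⊗ C) D).inv) ≫
          wedgeHom (α_ A B C).inv (𝟙 D) := hom_eq (.b_five A B C D)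
    have h1 : wedgeHom (𝟙 A) (α_ B C D).hom ≫ wedgeHom (𝟙 A) (α_ B C D).inv = 𝟙 _ := by
      rw [← wedgeHom_comp, Iso.hom_inv_id, Category.id_comp]
      exact hom_eq (.wedge_one _ _)
    have h2 : wedgeHom (α_ A B C).inv (𝟙 D) ≫ wedgeHom (α_ A B C).hom (𝟙 D) = 𝟙 _ := by
      rw [← wedgeHom_comp, Iso.inv_hom_id, Category.id_comp]
      exact hom_eq (.wedge_one _ _)
    rw [← cancel_mono (α_ A B (C ⊗ D)).inv, ← cancel_mono (α_ (A ⊗ B) C D).inv]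
    simp only [Category.assoc, Iso.hom_inv_id, Category.comp_id]
    rw [h]
    change wedgeHom (α_ A B C).hom (𝟙 D) ≫ (α_ A (B ⊗ C) D).hom ≫ wedgeHom (𝟙 A) (α_ B C D).hom ≫
      (wedgeHom (𝟙 A) (α_ B C D).inv ≫ (α_ A (B ⊗ C) D).inv) ≫ wedgeHom (α_ A B C).inv (𝟙 D) = _
    simp only [Category.assoc]
    rw [reassoc_of% h1, Iso.hom_inv_id_assoc, ← wedgeHom_comp, Iso.hom_inv_id, Category.id_comp]
    exact hom_eq (.wedge_one _ _))
  (triangle := fun A C => by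
    have h : (α_ A (𝟙_ _) C).inv = wedgeHom (𝟙 A) (λ_ C).hom ≫ wedgeHom (ρ_ A).inv (𝟙 C) :=
      hom_eq (.b_delta_sigma A C)
    have h2 : wedgeHom (ρ_ A).inv (𝟙 C) ≫ wedgeHom (ρ_ A).hom (𝟙 C) = 𝟙 _ := by
      rw [← wedgeHom_comp, Iso.inv_hom_id, Category.id_comp]
      exact hom_eq (.wedge_one _ _)
    have h3 := h =≫ wedgeHom (ρ_ A).hom (𝟙 C)
    rw [Category.assoc, h2, Category.comp_id] at h3
    rw [← cancel_epi (α_ A (𝟙_ _) C).inv, Iso.inv_hom_id_assoc]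
    exact h3.symm)

/-- The braiding, given by the arrow terms `c`. -/
def braidIso (A B : SDot V) : A ⊗ B ≅ B ⊗ A :=
  ⟨hom (.c A B), hom (.c B A), hom_eq (.c_c A B), hom_eq (.c_c B A)⟩

theorem braidIso_natural {A B D E : SDot V} (f : A ⟶ D) (g : B ⟶ E) :
    (f ⊗ₘ g) ≫ (braidIso D E).hom = (braidIso A B).hom ≫ (g ⊗ₘ f) := by
  obtain ⟨f, rfl⟩ := exists_hom f
  obtain ⟨g, rfl⟩ := exists_hom g
  exact (hom_eq (.c_nat f g)).symm

theorem braidIso_hexagon (A B C : SDot V) :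
    (α_ A B C).hom ≫ (braidIso A (B ⊗ C)).hom ≫ (α_ B C A).hom =
      ((braidIso A B).hom ▷ C) ≫ (α_ B A C).hom ≫ (B ◁ (braidIso A C).hom) := by
  have h : (braidIso A (B ⊗ C)).hom = (((((α_ A B C).inv ≫ (braidIso A B).hom ▷ C) ≫
      (α_ B A C).hom) ≫ B ◁ (braidIso A C).hom) ≫ (α_ B C A).inv) := hom_eq (.b_c A B C)
  simp [h]

instance : BraidedCategory (SDot V) where
  braiding := braidIso
  braiding_naturality_right X _ _ f := by simpa using braidIso_natural (𝟙 X) f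
  braiding_naturality_left f Z := by simpa using braidIso_natural f (𝟙 Z)
  hexagon_forward := braidIso_hexagon
  hexagon_reverse A B C := by
    -- The reverse hexagon is the inverse of the forward one for `C, A, B`: inverting a braiding
    -- only exchanges its indices.
    have h := congrArg Iso.inv (a₁ := α_ C A B ≪≫ braidIso C (A ⊗ B) ≪≫ α_ A B C)
      (a₂ := whiskerRightIso (braidIso C A) B ≪≫ α_ A C B ≪≫ whiskerLeftIso A (braidIso C B))
      (Iso.ext (braidIso_hexagon C A B))
    simp only [Iso.trans_inv, whiskerRightIso_inv, whiskerLeftIso_inv, Category.assoc] at h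
    exact h

instance : SymmetricCategory (SDot V) where
  symmetry A B := (braidIso A B).hom_inv_id

/-- Reflexivity. -/
def rHom (x : SDotTerm V) : 𝟙_ (SDot V) ⟶ le x x := hom (.r x)

/-- Transitivity. -/
def tHom (x y z : SDotTerm V) : le x y ⊗ le y z ⟶ le x z := hom (.t x y z)

/-- Compatibility of the operation with the relation. -/
def aHom (x y z w : SDotTerm V) : le x y ⊗ le z w ⟶ le (.op x z) (.op y w) := hom (.a x y z w)

theorem rHom_tHom_right (x y : SDotTerm V) :
    le x y ◁ rHom y ≫ tHom x y y = (ρ_ (le x y)).hom := hom_eq (.r_t_delta x y)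

theorem rHom_tHom_left (x y : SDotTerm V) :
    rHom y ▷ le y x ≫ tHom y y x = (λ_ (le y x)).hom := hom_eq (.r_t_sigma x y)

theorem tHom_assoc (x y z w : SDotTerm V) :
    tHom x y z ▷ le z w ≫ tHom x z w = (α_ _ _ _).hom ≫ le x y ◁ tHom y z w ≫ tHom x y w := by
  rw [← Iso.inv_comp_eq, ← Category.assoc]
  exact (hom_eq (.t_b x y z w)).symm

theorem rHom_aHom (x y : SDotTerm V) :
    (ρ_ (𝟙_ (SDot V))).inv ≫ (rHom x ⊗ₘ rHom y) ≫ aHom x x y y = rHom (.op x y) :=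
  hom_eq (.trans (.comp_assoc _ _ _) (.r_a x y))

theorem tHom_aHom (t₁ s₁ r₁ t₂ s₂ r₂ : SDotTerm V) :
    (tHom t₁ s₁ r₁ ⊗ₘ tHom t₂ s₂ r₂) ≫ aHom t₁ r₁ t₂ r₂ =
      tensorμ (le t₁ s₁) (le s₁ r₁) (le t₂ s₂) (le s₂ r₂) ≫
        (aHom t₁ s₁ t₂ s₂ ⊗ₘ aHom s₁ r₁ s₂ r₂) ≫ tHom (.op t₁ t₂) (.op s₁ s₂) (.op r₁ r₂) := by
  have h : (tHom t₁ s₁ r₁ ⊗ₘ tHom t₂ s₂ r₂) ≫ aHom t₁ r₁ t₂ r₂ =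
      (hom (.cm (le t₁ s₁) (le s₁ r₁) (le t₂ s₂) (le s₂ r₂)) ≫
        (aHom t₁ s₁ t₂ s₂ ⊗ₘ aHom s₁ r₁ s₂ r₂)) ≫ tHom (.op t₁ t₂) (.op s₁ s₂) (.op r₁ r₂) :=
    hom_eq (.t_a t₁ s₁ r₁ t₂ s₂ r₂)
  rw [h, Category.assoc]
  congr 1
  have h2 : hom (.cm (le t₁ s₁) (le s₁ r₁) (le t₂ s₂) (le s₂ r₂)) = (((α_ _ _ _).hom ≫
    _ ◁ (((α_ _ _ _).inv ≫ (β_ _ _).hom ▷ _) ≫ (α_ _ _ _).hom)) ≫ (α_ _ _ _).inv) := rfl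
  rw [h2]
  simp [tensorμ]

/-! ## Colourings constant on the classes of diagrams -/

open ArrowTerm

/-- The colourings `p` and `q` are constant on the classes of the diagram of `f`. -/
def SatG {A B : SDot V} (f : A ⟶ B) (p : Col A) (q : Col B) : Prop := Br.Sat ((G V).map f) p q

theorem satG_of_map_eq {A B : SDot V} {f g : A ⟶ B} (h : (G V).map f = (G V).map g) (p q) :
    SatG f p q ↔ SatG g p q := by rw [SatG, h, SatG]

section

variable {A B C D : SDot V}

/-- The colouring of a conjunction, restricted to the first conjunct. -/
def cfst (p : Col (A ⊗ B)) : Col A := andFst p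
/-- The colouring of a conjunction, restricted to the second conjunct. -/
def csnd (p : Col (A ⊗ B)) : Col B := andSnd p
/-- The colouring of a conjunction made of colourings of the conjuncts. -/
def cmk (p : Col A) (q : Col B) : Col (A ⊗ B) := mkAnd p q

@[simp] theorem cfst_cmk (p : Col A) (q : Col B) : cfst (cmk p q) = p := andFst_mk p q
@[simp] theorem csnd_cmk (p : Col A) (q : Col B) : csnd (cmk p q) = q := andSnd_mk p q
theorem col_ext {p q : Col (A ⊗ B)} : p = q ↔ cfst p = cfst q ∧ csnd p = csnd q := and_ext
theorem exists_col {P : Col (A ⊗ B) → Prop} : (∃ p, P p) ↔ ∃ p q, P (cmk p q) := exists_and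
theorem exists_colUnit {P : Col (𝟙_ (SDot V)) → Prop} : (∃ p, P p) ↔ P Fin.elim0 := exists_top
instance : Subsingleton (Col (𝟙_ (SDot V))) := ⟨fun _ _ => top_ext.2 trivial⟩
instance : Unique (Col (𝟙_ (SDot V))) := ⟨⟨Fin.elim0⟩, fun _ => Subsingleton.elim _ _⟩
theorem colUnit_ext (p q : Col (𝟙_ (SDot V))) : p = q ↔ True := top_ext

theorem satG_id (p q : Col A) : SatG (𝟙 A) p q ↔ p = q := sat_one p q
theorem satG_comp (f : A ⟶ B) (g : B ⟶ C) (p q) :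
    SatG (f ≫ g) p q ↔ ∃ s, SatG f p s ∧ SatG g s q := by
  obtain ⟨f, rfl⟩ := exists_hom f
  obtain ⟨g, rfl⟩ := exists_hom g
  exact sat_comp g f p q
theorem satG_tensor (f : A ⟶ B) (g : C ⟶ D) (p q) :
    SatG (f ⊗ₘ g) p q ↔ SatG f (cfst p) (cfst q) ∧ SatG g (csnd p) (csnd q) := by
  obtain ⟨f, rfl⟩ := exists_hom f
  obtain ⟨g, rfl⟩ := exists_hom g
  exact sat_wedge f g p q
theorem satG_whiskerLeft (f : A ⟶ B) (p q) :
    SatG (C ◁ f) p q ↔ cfst p = cfst q ∧ SatG f (csnd p) (csnd q) := by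
  rw [← id_tensorHom, satG_tensor, satG_id]
theorem satG_whiskerRight (f : A ⟶ B) (p q) :
    SatG (f ▷ C) p q ↔ SatG f (cfst p) (cfst q) ∧ csnd p = csnd q := by
  rw [← tensorHom_id, satG_tensor, satG_id]
theorem satG_assoc_hom (p q) : SatG (α_ A B C).hom p q ↔ cfst (cfst p) = cfst q ∧
    csnd (cfst p) = cfst (csnd q) ∧ csnd p = csnd (csnd q) := sat_bFrom p q
theorem satG_assoc_inv (p q) : SatG (α_ A B C).inv p q ↔ cfst p = cfst (cfst q) ∧
    cfst (csnd p) = csnd (cfst q) ∧ csnd (csnd p) = csnd q := sat_bTo p q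
theorem satG_leftUnitor_hom (p q) : SatG (λ_ A).hom p q ↔ csnd p = q := sat_sigmaTo p q
theorem satG_leftUnitor_inv (p q) : SatG (λ_ A).inv p q ↔ p = csnd q := sat_sigmaFrom p q
theorem satG_rightUnitor_hom (p q) : SatG (ρ_ A).hom p q ↔ cfst p = q := sat_deltaTo p q
theorem satG_rightUnitor_inv (p q) : SatG (ρ_ A).inv p q ↔ p = cfst q := sat_deltaFrom p q
theorem satG_braiding (p q) : SatG (β_ A B).hom p q ↔ cfst p = csnd q ∧ csnd p = cfst q :=
  sat_c p q
theorem satG_rHom (x : SDotTerm V) (p q) : SatG (rHom x) p q ↔ leFst q = leSnd q := sat_r p q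
theorem satG_tHom (x y z : SDotTerm V) (p q) : SatG (tHom x y z) p q ↔
    leFst (cfst p) = leFst q ∧ leSnd (cfst p) = leFst (csnd p) ∧ leSnd (csnd p) = leSnd q :=
  sat_t p q
theorem satG_aHom (x y z w : SDotTerm V) (p q) : SatG (aHom x y z w) p q ↔
    leFst (cfst p) = opFst (leFst q) ∧ leSnd (cfst p) = opFst (leSnd q) ∧
      leFst (csnd p) = opSnd (leFst q) ∧ leSnd (csnd p) = opSnd (leSnd q) :=
  sat_a p q

end

/-! ## Extraction of a conjunct -/

/-- `Ext X A A'` is an occurrence of `X` as a conjunct of `A`; the formula `A'` is obtained from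
`A` by replacing that occurrence by `⊤`. -/
inductive Ext (X : SDot V) : SDot V → SDot V → Type u
  | here : Ext X X (𝟙_ (SDot V))
  | left {A A' : SDot V} (e : Ext X A A') (B : SDot V) : Ext X (A ⊗ B) (A' ⊗ B)
  | right {A A' : SDot V} (B : SDot V) (e : Ext X A A') : Ext X (B ⊗ A) (B ⊗ A')

namespace Ext

variable {X A A' : SDot V}

/-- The isomorphism that brings the conjunct to the front. -/
def iso : ∀ {A A' : SDot V}, Ext X A A' → (A ≅ X ⊗ A')
  | _, _, here => (ρ_ X).symm
  | _, _, left e B => whiskerRightIso e.iso B ≪≫ α_ _ _ _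
  | _, _, right B e => whiskerLeftIso B e.iso ≪≫ (α_ _ _ _).symm ≪≫
      whiskerRightIso (β_ _ _) _ ≪≫ α_ _ _ _

/-- The colouring of the conjunct. -/
def part : ∀ {A A' : SDot V}, Ext X A A' → Col A → Col X
  | _, _, here, p => p
  | _, _, left e _, p => e.part (cfst p)
  | _, _, right _ e, p => e.part (csnd p)

/-- The colouring of what remains. -/
def rest : ∀ {A A' : SDot V}, Ext X A A' → Col A → Col A'
  | _, _, here, _ => default
  | _, _, left e _, p => cmk (e.rest (cfst p)) (csnd p)
  | _, _, right _ e, p => cmk (cfst p) (e.rest (csnd p))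

/-- The colouring made of a colouring of the conjunct and one of what remains. -/
def mk : ∀ {A A' : SDot V}, Ext X A A' → Col X → Col A' → Col A
  | _, _, here, x, _ => x
  | _, _, left e _, x, p => cmk (e.mk x (cfst p)) (csnd p)
  | _, _, right _ e, x, p => cmk (cfst p) (e.mk x (csnd p))

@[simp] theorem part_mk (e : Ext X A A') (x : Col X) (p : Col A') : e.part (e.mk x p) = x := by
  induction e with
  | here => rfl
  | left e B ih => simp [part, mk, ih]
  | right B e ih => simp [part, mk, ih]

@[simp] theorem rest_mk (e : Ext X A A') (x : Col X) (p : Col A') : e.rest (e.mk x p) = p := by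
  induction e with
  | here => exact Subsingleton.elim _ _
  | left e B ih => simp [rest, mk, ih, SDot.col_ext]
  | right B e ih => simp [rest, mk, ih, SDot.col_ext]

@[simp] theorem mk_part_rest (e : Ext X A A') (p : Col A) : e.mk (e.part p) (e.rest p) = p := by
  induction e with
  | here => rfl
  | left e B ih => simp [part, rest, mk, ih, SDot.col_ext]
  | right B e ih => simp [part, rest, mk, ih, SDot.col_ext]

theorem col_ext (e : Ext X A A') {p q : Col A} :
    p = q ↔ e.part p = e.part q ∧ e.rest p = e.rest q := by
  constructor
  · rintro rfl
    exact ⟨rfl, rfl⟩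
  · rintro ⟨h1, h2⟩
    rw [← e.mk_part_rest p, h1, h2, e.mk_part_rest]

theorem satG_hom (e : Ext X A A') (p : Col A) (q : Col (X ⊗ A')) :
    SatG e.iso.hom p q ↔ e.part p = cfst q ∧ e.rest p = csnd q := by
  induction e with
  | here =>
    rw [iso, Iso.symm_hom, satG_rightUnitor_inv]
    exact ⟨fun h => ⟨h, Subsingleton.elim _ _⟩, fun h => h.1⟩
  | left e B ih =>
    simp only [iso, Iso.trans_hom, whiskerRightIso_hom, satG_comp, satG_whiskerRight,
      satG_assoc_hom, exists_col, ih, cfst_cmk, csnd_cmk, part, rest, SDot.col_ext]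
    grind
  | right B e ih =>
    simp only [iso, Iso.trans_hom, whiskerRightIso_hom, whiskerLeftIso_hom, Iso.symm_hom,
      satG_comp, satG_whiskerRight, satG_whiskerLeft, satG_braiding, satG_assoc_inv,
      satG_assoc_hom, exists_col, ih, cfst_cmk, csnd_cmk, part, rest, SDot.col_ext]
    grind

end Ext

/-! ### Colourings that separate occurrences -/

theorem occ_pos (x : SDotTerm V) : 0 < x.occ := by
  induction x with
  | var => exact Nat.one_pos
  | op x y hx _ => exact Nat.add_pos_left hx _

/-- Terms are nonempty, so the two constant colourings differ. All later arguments that tell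
occurrences apart rest on this. -/
theorem const_ne {x : SDotTerm V} : (fun _ => True : TCol x) ≠ fun _ => False := fun h =>
  (congrFun h ⟨0, occ_pos x⟩).mp trivial

theorem exists_ne_col (x y : SDotTerm V) (c : Col (le x y)) : ∃ c', c ≠ c' := by
  by_contra! h
  refine const_ne (x := x) ?_
  have := (h (mkLe (fun _ => True) fun _ => False)).symm.trans (h (mkLe (fun _ => False) fun _ => False))
  simpa [leFst_mk] using congrArg leFst this

/-! ## Formulae without atoms -/

/-- Formulae without atoms. -/
def Triv : SDot V → Prop
  | le _ _ => False
  | top => True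
  | and A B => Triv A ∧ Triv B

/-- Formulae without atoms are isomorphic to the unit. -/
def trivIso : ∀ {A : SDot V}, Triv A → (A ≅ 𝟙_ (SDot V))
  | top, _ => Iso.refl _
  | and _ _, h => (trivIso h.1 ⊗ᵢ trivIso h.2) ≪≫ λ_ _

theorem Ext.not_triv {x y : SDotTerm V} {A A' : SDot V} (e : Ext (le x y) A A') : ¬ Triv A := by
  induction e with
  | here => exact id
  | left e B ih => exact fun h => ih h.1
  | right B e ih => exact fun h => ih h.2

theorem triv_or_ext (A : SDot V) : Triv A ∨ ∃ x y A', Nonempty (Ext (le x y) A A') := by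
  induction A with
  | le x y => exact .inr ⟨x, y, _, ⟨.here⟩⟩
  | top => exact .inl trivial
  | and A B hA hB =>
    rcases hA with hA | ⟨x, y, A', ⟨e⟩⟩
    · rcases hB with hB | ⟨x, y, B', ⟨e⟩⟩
      · exact .inl ⟨hA, hB⟩
      · exact .inr ⟨x, y, _, ⟨.right A e⟩⟩
    · exact .inr ⟨x, y, _, ⟨.left e B⟩⟩

/-- The number of atoms. -/
def atoms : SDot V → ℕ
  | le _ _ => 1
  | top => 0
  | and A B => A.atoms + B.atoms

theorem Ext.atoms_lt {x y : SDotTerm V} {A A' : SDot V} (e : Ext (le x y) A A') :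
    A'.atoms < A.atoms := by
  induction e with
  | here => exact Nat.one_pos
  | left e B ih => exact Nat.add_lt_add_right ih _
  | right B e ih => exact Nat.add_lt_add_left ih _

/-! ## Structural arrows -/

/-- The structural arrows of a symmetric monoidal category. -/
inductive Str : ∀ {A B : SDot V}, (A ⟶ B) → Prop
  | id (A : SDot V) : Str (𝟙 A)
  | comp {A B C : SDot V} {f : A ⟶ B} {g : B ⟶ C} : Str f → Str g → Str (f ≫ g)
  | whiskerLeft (C : SDot V) {A B : SDot V} {f : A ⟶ B} : Str f → Str (C ◁ f)
  | whiskerRight {A B : SDot V} {f : A ⟶ B} (C : SDot V) : Str f → Str (f ▷ C)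
  | assoc_hom (A B C : SDot V) : Str (α_ A B C).hom
  | assoc_inv (A B C : SDot V) : Str (α_ A B C).inv
  | leftUnitor_hom (A : SDot V) : Str (λ_ A).hom
  | leftUnitor_inv (A : SDot V) : Str (λ_ A).inv
  | rightUnitor_hom (A : SDot V) : Str (ρ_ A).hom
  | rightUnitor_inv (A : SDot V) : Str (ρ_ A).inv
  | braiding (A B : SDot V) : Str (β_ A B).hom

/-- A structural arrow merely moves occurrences about, so a colouring of the source can be
transported along it. -/
theorem Str.exists_satG {A B : SDot V} {f : A ⟶ B} (h : Str f) (p : Col A) : ∃ q, SatG f p q := by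
  induction h with
  | id A => exact ⟨p, (satG_id _ _).2 rfl⟩
  | comp _ _ ih1 ih2 =>
    obtain ⟨s, hs⟩ := ih1 p
    obtain ⟨q, hq⟩ := ih2 s
    exact ⟨q, (satG_comp _ _ _ _).2 ⟨s, hs, hq⟩⟩
  | whiskerLeft C _ ih =>
    obtain ⟨q, hq⟩ := ih (csnd p)
    exact ⟨cmk (cfst p) q, (satG_whiskerLeft _ _ _).2 (by simpa using hq)⟩
  | whiskerRight C _ ih =>
    obtain ⟨q, hq⟩ := ih (cfst p)
    exact ⟨cmk q (csnd p), (satG_whiskerRight _ _ _).2 (by simpa using hq)⟩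
  | _ =>
    simp [satG_assoc_hom, satG_assoc_inv, satG_leftUnitor_hom, satG_leftUnitor_inv,
      satG_rightUnitor_hom, satG_rightUnitor_inv, satG_braiding, exists_col]

/-! ### Structural arrows into formulae without atoms -/

theorem triv_unit : Triv (𝟙_ (SDot V)) := trivial

theorem Triv.tensor {A B : SDot V} (hA : Triv A) (hB : Triv B) : Triv (A ⊗ B) := ⟨hA, hB⟩

theorem Triv.fst {A B : SDot V} (h : Triv (A ⊗ B)) : Triv A := And.left h

theorem Triv.snd {A B : SDot V} (h : Triv (A ⊗ B)) : Triv B := And.right h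

theorem trivIso_unit (h : Triv (𝟙_ (SDot V))) : (trivIso h).hom = 𝟙 _ := rfl

theorem trivIso_tensor {A B : SDot V} (h : Triv (A ⊗ B)) :
    (trivIso h).hom = ((trivIso h.fst).hom ⊗ₘ (trivIso h.snd).hom) ≫ (λ_ (𝟙_ (SDot V))).hom := rfl

/-- Structural arrows neither create nor destroy atoms. Without atoms only the unit remains, where
the braiding is the identity and both unitors agree. This is the base case of coherence. -/
theorem Str.triv {A B : SDot V} {f : A ⟶ B} (h : Str f) (hB : Triv B) :
    ∃ hA : Triv A, f ≫ (trivIso hB).hom = (trivIso hA).hom := by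
  induction h with
  | id A => exact ⟨hB, Category.id_comp _⟩
  | comp _ _ ih1 ih2 =>
    obtain ⟨h2, e2⟩ := ih2 hB
    obtain ⟨h1, e1⟩ := ih1 h2
    exact ⟨h1, by rw [Category.assoc, e2, e1]⟩
  | whiskerLeft C _ ih =>
    obtain ⟨h1, e1⟩ := ih hB.snd
    exact ⟨hB.fst.tensor h1, by rw [trivIso_tensor, trivIso_tensor, ← e1, ← id_tensorHom,
      tensorHom_comp_tensorHom_assoc, Category.id_comp]⟩
  | whiskerRight C _ ih =>
    obtain ⟨h1, e1⟩ := ih hB.fst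
    exact ⟨h1.tensor hB.snd, by rw [trivIso_tensor, trivIso_tensor, ← e1, ← tensorHom_id,
      tensorHom_comp_tensorHom_assoc, Category.id_comp]⟩
  | assoc_hom A B C =>
    refine ⟨(hB.fst.tensor hB.snd.fst).tensor hB.snd.snd, ?_⟩
    simp only [trivIso_tensor]
    generalize (trivIso _).hom = a, (trivIso _).hom = b, (trivIso _).hom = c
    simp [MonoidalCategory.tensorHom_def]
  | assoc_inv A B C =>
    refine ⟨hB.fst.fst.tensor (hB.fst.snd.tensor hB.snd), ?_⟩
    simp only [trivIso_tensor]
    generalize (trivIso _).hom = a, (trivIso _).hom = b, (trivIso _).hom = c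
    simp [MonoidalCategory.tensorHom_def]
  | leftUnitor_hom A =>
    refine ⟨triv_unit.tensor hB, ?_⟩
    rw [trivIso_tensor, trivIso_unit]; simp
  | leftUnitor_inv A => exact ⟨hB.snd, by rw [trivIso_tensor, trivIso_unit]; simp⟩
  | rightUnitor_hom A =>
    refine ⟨hB.tensor triv_unit, ?_⟩
    rw [trivIso_tensor, trivIso_unit]
    simp [unitors_equal]
  | rightUnitor_inv A =>
    refine ⟨hB.fst, ?_⟩
    rw [trivIso_tensor, trivIso_unit]; simp [unitors_equal]
  | braiding A B =>
    refine ⟨hB.snd.tensor hB.fst, ?_⟩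
    simp only [trivIso_tensor]
    rw [← BraidedCategory.braiding_naturality_assoc, braiding_tensorUnit_left,
      unitors_equal]
    simp

/-! ### Extraction of atoms along structural arrows -/

theorem Ext.here_hom (X : SDot V) : (here : Ext X X _).iso.hom = (ρ_ X).inv := rfl

theorem Ext.left_hom {X A A' : SDot V} (e : Ext X A A') (B : SDot V) :
    (e.left B).iso.hom = e.iso.hom ▷ B ≫ (α_ _ _ _).hom := rfl

theorem Ext.right_hom {X A A' : SDot V} (B : SDot V) (e : Ext X A A') :
    (e.right B).iso.hom =
      B ◁ e.iso.hom ≫ (α_ _ _ _).inv ≫ (β_ _ _).hom ▷ _ ≫ (α_ _ _ _).hom := rfl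

/-- An atom of the target comes from exactly one atom of the source, and removing both leaves a
structural arrow. Since an atom is neither `⊤` nor a conjunction, an occurrence of it always lies
within one of the variables of a structural constraint, and naturality does the rest. -/
theorem Str.extract {A B : SDot V} {f : A ⟶ B} (h : Str f) {x y : SDotTerm V} {B' : SDot V}
    (e : Ext (le x y) B B') : ∃ (A' : SDot V) (e' : Ext (le x y) A A') (f' : A' ⟶ B'),
      Str f' ∧ f ≫ e.iso.hom = e'.iso.hom ≫ le x y ◁ f' := by
  induction h generalizing B' with
  | id A => exact ⟨_, e, 𝟙 _, .id _, by simp⟩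
  | comp _ _ ih1 ih2 =>
    obtain ⟨_, e2, f2, s2, h2⟩ := ih2 e
    obtain ⟨_, e1, f1, s1, h1⟩ := ih1 e2
    exact ⟨_, e1, f1 ≫ f2, s1.comp s2, by simp [h2, reassoc_of% h1]⟩
  | whiskerLeft C s ih =>
    cases e with
    | left e D =>
      refine ⟨_, .left e _, _, .whiskerLeft _ s, ?_⟩
      simp [Ext.left_hom, whisker_exchange_assoc]
    | right D e =>
      obtain ⟨_, e1, f1, s1, h1⟩ := ih e
      refine ⟨_, .right _ e1, _ ◁ f1, .whiskerLeft _ s1, ?_⟩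
      simp only [Ext.right_hom, ← whiskerLeft_comp_assoc, h1]
      simp only [whiskerLeft_comp, Category.assoc, associator_inv_naturality_right_assoc,
        whisker_exchange_assoc, associator_naturality_right]
  | whiskerRight C s ih =>
    cases e with
    | left e D =>
      obtain ⟨_, e1, f1, s1, h1⟩ := ih e
      refine ⟨_, .left e1 _, f1 ▷ _, .whiskerRight _ s1, ?_⟩
      simp only [Ext.left_hom, ← comp_whiskerRight_assoc, h1]
      simp
    | right D e =>
      refine ⟨_, .right _ e, _, .whiskerRight _ s, ?_⟩
      rw [Ext.right_hom, ← whisker_exchange_assoc, associator_inv_naturality_left_assoc,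
        ← comp_whiskerRight_assoc, BraidedCategory.braiding_naturality_left]
      simp [Ext.right_hom]
  | assoc_hom A B C =>
    cases e with
    | left e D =>
      refine ⟨_, .left (.left e _) _, _, .assoc_hom _ _ _, ?_⟩
      simp [Ext.left_hom]
    | right D e =>
      cases e with
      | left e D =>
        refine ⟨_, .left (.right _ e) _, _, .assoc_hom _ _ _, ?_⟩
        simp [Ext.left_hom, Ext.right_hom]
      | right D e =>
        refine ⟨_, .right _ e, _, .assoc_hom _ _ _, ?_⟩
        simp [Ext.right_hom]
  | assoc_inv A B C =>
    cases e with
    | left e D =>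
      cases e with
      | left e D =>
        refine ⟨_, .left e _, _, .assoc_inv _ _ _, ?_⟩
        simp [Ext.left_hom]
      | right D e =>
        refine ⟨_, .right _ (.left e _), _, .assoc_inv _ _ _, ?_⟩
        simp [Ext.left_hom, Ext.right_hom]
    | right D e =>
      refine ⟨_, .right _ (.right _ e), _, .assoc_inv _ _ _, ?_⟩
      simp [Ext.right_hom]
  | leftUnitor_hom A =>
    refine ⟨_, .right _ e, _, .leftUnitor_hom _, ?_⟩
    simp [Ext.right_hom]
  | leftUnitor_inv A =>
    cases e with
    | left e D => cases e
    | right D e =>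
      refine ⟨_, e, _, .leftUnitor_inv _, ?_⟩
      simp [Ext.right_hom]
  | rightUnitor_hom A =>
    refine ⟨_, .left e _, _, .rightUnitor_hom _, ?_⟩
    simp [Ext.left_hom]
  | rightUnitor_inv A =>
    cases e with
    | right D e => cases e
    | left e D =>
      refine ⟨_, e, _, .rightUnitor_inv _, ?_⟩
      simp [Ext.left_hom]
  | braiding A B =>
    cases e with
    | left e D =>
      refine ⟨_, .right _ e, _, .braiding _ _, ?_⟩
      rw [Ext.left_hom, ← BraidedCategory.braiding_naturality_right_assoc]
      simp [Ext.right_hom]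
    | right D e =>
      refine ⟨_, .left e _, _, .braiding _ _, ?_⟩
      rw [Ext.right_hom, ← BraidedCategory.braiding_naturality_left_assoc]
      simp [Ext.left_hom, ← comp_whiskerRight_assoc]

/-! ## Coherence of structural arrows -/

theorem Ext.str {X A A' : SDot V} (e : Ext X A A') : Str e.iso.hom := by
  induction e with
  | here => exact .rightUnitor_inv _
  | left e B ih => exact .comp (.whiskerRight _ ih) (.assoc_hom _ _ _)
  | right B e ih =>
    exact .comp (.whiskerLeft _ ih)
      (.comp (.assoc_inv _ _ _) (.comp (.whiskerRight _ (.braiding _ _)) (.assoc_hom _ _ _)))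

/-- Occurrences of an atom that have the same colouring throughout are equal. -/
theorem Ext.eq_of_part {x y : SDotTerm V} {A A₁ A₂ : SDot V} (e₁ : Ext (le x y) A A₁)
    (e₂ : Ext (le x y) A A₂) (h : ∀ p, e₁.part p = e₂.part p) :
    (⟨A₁, e₁⟩ : Σ A', Ext (le x y) A A') = ⟨A₂, e₂⟩ := by
  induction e₁ generalizing A₂ with
  | here => cases e₂; rfl
  | left e₁ B ih =>
    cases e₂ with
    | left e₂ =>
      cases ih e₂ fun p => by simpa [part] using h (cmk p fun _ => True)
      rfl
    | right _ e₂ =>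
      -- Occurrences in different conjuncts can be coloured independently, here by the constant
      -- `True` and by some other `c`.
      obtain ⟨c, hc⟩ := exists_ne_col x y fun _ => True
      refine absurd ?_ hc
      simpa [part] using h (cmk (e₁.mk (fun _ => True) fun _ => True) (e₂.mk c fun _ => True))
  | right B e₁ ih =>
    cases e₂ with
    | right _ e₂ =>
      cases ih e₂ fun p => by simpa [part] using h (cmk (fun _ => True) p)
      rfl
    | left e₂ =>
      obtain ⟨c, hc⟩ := exists_ne_col x y fun _ => True
      refine absurd ?_ hc
      simpa [part] using h (cmk (e₂.mk c fun _ => True) (e₁.mk (fun _ => True) fun _ => True))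

/-- Symmetric monoidal coherence, by induction on the number of atoms of the target. An atom of the
target is traced back through both arrows; the diagrams show that it has the same origin, and what
remains is handled by induction. From here on, structural identities are verified on colourings. -/
theorem Str.eq_of_satG {A B : SDot V} {f g : A ⟶ B} (hf : Str f) (hg : Str g)
    (h : ∀ p q, SatG f p q ↔ SatG g p q) : f = g := by
  induction hn : B.atoms using Nat.strong_induction_on generalizing A B with
  | _ n ih =>
    rcases triv_or_ext B with hB | ⟨x, y, B', ⟨e⟩⟩
    · rw [← cancel_mono (trivIso hB).hom, (hf.triv hB).2, (hg.triv hB).2]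
    · obtain ⟨A₁, e₁, f', hf', h₁⟩ := hf.extract e
      obtain ⟨A₂, e₂, g', hg', h₂⟩ := hg.extract e
      have key : ∀ (k : A ⟶ B) {A₁ : SDot V} (e₁ : Ext (le x y) A A₁) (k' : A₁ ⟶ B'),
          k ≫ e.iso.hom = e₁.iso.hom ≫ _ ◁ k' → ∀ p q,
          (SatG k p q ↔ e₁.part p = e.part q ∧ SatG k' (e₁.rest p) (e.rest q)) := by
        intro k A₁ e₁ k' hk p q
        have h3 := satG_of_map_eq (congrArg (G V).map hk) p (cmk (e.part q) (e.rest q))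
        simp only [satG_comp, Ext.satG_hom, satG_whiskerLeft, cfst_cmk, csnd_cmk, exists_col] at h3
        constructor
        · intro hp
          obtain ⟨_, _, ⟨rfl, rfl⟩, h4⟩ := h3.1 ⟨q, hp, rfl, rfl⟩
          exact h4
        · intro hp
          obtain ⟨q', h4, h5⟩ := h3.2 ⟨_, _, ⟨rfl, rfl⟩, hp⟩
          exact e.col_ext.2 h5 ▸ h4
      have k₁ := key f e₁ f' h₁
      have k₂ := key g e₂ g' h₂
      -- Both extracted atoms of the source receive the colour that the atom `e` has in the target,
      -- for a target colouring that is related to `p` by either arrow.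
      cases e₁.eq_of_part e₂ fun p => by
        obtain ⟨q, hq⟩ := hf.exists_satG p
        exact ((k₁ p q).1 hq).1.trans ((k₂ p q).1 ((h p q).1 hq)).1.symm
      have : f' = g' := ih _ (hn ▸ e.atoms_lt) hf' hg' (fun p q => by
        -- Any colour of the extracted atom will do: it is the same above and below, so only the
        -- condition on the remainders is left.
        have c : Col (le x y) := fun _ => True
        have h4 := k₁ (e₁.mk c p) (e.mk c q)
        rw [h, k₂] at h4
        simpa using h4.symm) rfl
      rw [← cancel_mono e.iso.hom, h₁, h₂, this]

attribute [simp] satG_id satG_comp satG_whiskerLeft satG_whiskerRight satG_tensor satG_assoc_hom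
  satG_assoc_inv satG_leftUnitor_hom satG_leftUnitor_inv satG_rightUnitor_hom satG_rightUnitor_inv
  satG_braiding Ext.satG_hom

/-! ## Actions -/

section action

variable {X Y Z W Z₁ Z₂ Y₁ : SDot V}

/-- The isomorphism exchanging the last two of three factors. -/
def swapRight (Z Y X : SDot V) : (Z ⊗ Y) ⊗ X ⟶ (Z ⊗ X) ⊗ Y :=
  (α_ _ _ _).hom ≫ Z ◁ (β_ Y X).hom ≫ (α_ _ _ _).inv

theorem str_swapRight : Str (swapRight Z Y X) := by unfold swapRight; repeat constructor

@[simp] theorem satG_swapRight (p q) : SatG (swapRight Z Y X) p q ↔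
    cfst (cfst p) = cfst (cfst q) ∧ csnd (cfst p) = csnd q ∧ csnd p = csnd (cfst q) := by
  simp [swapRight, exists_col]
  grind

theorem swapRight_natural (f : Z ⟶ Z₁) :
    f ▷ Y ▷ X ≫ swapRight Z₁ Y X = swapRight Z Y X ≫ f ▷ X ▷ Y := by
  simp only [swapRight, associator_naturality_left_assoc, Category.assoc]
  rw [← whisker_exchange_assoc, associator_inv_naturality_left]

theorem swapRight_natural_right (f : W ⟶ X) :
    (Z ⊗ Y) ◁ f ≫ swapRight Z Y X = swapRight Z Y W ≫ (Z ◁ f) ▷ Y := by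
  simp only [swapRight, associator_naturality_right_assoc, Category.assoc]
  rw [← whiskerLeft_comp_assoc, BraidedCategory.braiding_naturality_right,
    whiskerLeft_comp_assoc, associator_inv_naturality_middle]

/-- Two actions in succession. -/
def act (m₁ : Z ⊗ X ⟶ Z₁) (m₂ : Z₁ ⊗ Y ⟶ Z₂) : Z ⊗ (X ⊗ Y) ⟶ Z₂ :=
  (α_ _ _ _).inv ≫ m₁ ▷ Y ≫ m₂

/-- An action on the first of two factors. -/
def actL (Y : SDot V) (m : Z ⊗ X ⟶ Z₁) : (Z ⊗ Y) ⊗ X ⟶ Z₁ ⊗ Y := swapRight Z Y X ≫ m ▷ Y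

/-- An action on the second of two factors. -/
def actR (Y : SDot V) (m : Z ⊗ X ⟶ Z₁) : (Y ⊗ Z) ⊗ X ⟶ Y ⊗ Z₁ := (α_ _ _ _).hom ≫ Y ◁ m

theorem actL_act (m₁ : Z ⊗ X ⟶ Z₁) (m₂ : Z₁ ⊗ Y ⟶ Z₂) :
    actL W (act m₁ m₂) = act (actL W m₁) (actL W m₂) := by
  -- Naturality takes `m₁` and `m₂` out, and what remains is structural.
  have h : swapRight Z W (X ⊗ Y) ≫ (α_ Z X Y).inv ▷ W =
      (α_ _ _ _).inv ≫ swapRight Z W X ▷ Y ≫ swapRight _ W Y := by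
    refine Str.eq_of_satG (by repeat first | exact str_swapRight | constructor)
      (by repeat first | exact str_swapRight | constructor) fun p q => ?_
    simp [exists_col, col_ext]
    grind
  simp only [act, actL, comp_whiskerRight, Category.assoc]
  rw [reassoc_of% h, ← reassoc_of% swapRight_natural m₁]

theorem actL_whiskerLeft (f : W ⟶ X) (m : Z ⊗ X ⟶ Z₁) :
    actL Y (Z ◁ f ≫ m) = (Z ⊗ Y) ◁ f ≫ actL Y m := by
  rw [actL, actL, reassoc_of% swapRight_natural_right f, comp_whiskerRight]

theorem actL_rightUnitor : actL Y (ρ_ Z).hom = (ρ_ (Z ⊗ Y)).hom := by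
  refine Str.eq_of_satG (by unfold actL swapRight; repeat constructor) (by constructor) fun p q => ?_
  simp [actL, exists_col, col_ext]

theorem actR_act (m₁ : Z ⊗ X ⟶ Z₁) (m₂ : Z₁ ⊗ Y ⟶ Z₂) :
    actR W (act m₁ m₂) = act (actR W m₁) (actR W m₂) := by
  simp [act, actR]

theorem actR_whiskerLeft (f : W ⟶ X) (m : Z ⊗ X ⟶ Z₁) :
    actR Y (Z ◁ f ≫ m) = (Y ⊗ Z) ◁ f ≫ actR Y m := by
  simp [actR]

theorem actR_rightUnitor : actR Y (ρ_ Z).hom = (ρ_ (Y ⊗ Z)).hom := by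
  simp [actR]

/-- Actions on different factors amount to one simultaneous action, here and in `act_actR_actL` for
the opposite order. Comparing the two shows that they commute up to the braiding of the acting
formulae. -/
theorem act_actL_actR (m₁ : Z ⊗ X ⟶ Z₁) (m₂ : Y ⊗ W ⟶ Y₁) :
    act (actL Y m₁) (actR Z₁ m₂) = tensorμ Z Y X W ≫ (m₁ ⊗ₘ m₂) := by
  have h : (α_ _ _ _).inv ≫ swapRight Z Y X ▷ W ≫ (α_ (Z ⊗ X) Y W).hom = tensorμ Z Y X W := by
    refine Str.eq_of_satG (by repeat first | exact str_swapRight | constructor)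
      (by unfold tensorμ; repeat constructor) fun p q => ?_
    simp [tensorμ, exists_col, col_ext]
    grind
  rw [← h]
  simp [act, actL, actR, MonoidalCategory.tensorHom_def]

theorem act_actR_actL (m₁ : Z ⊗ X ⟶ Z₁) (m₂ : Y ⊗ W ⟶ Y₁) :
    act (actR Z m₂) (actL Y₁ m₁) = _ ◁ (β_ _ _).hom ≫ tensorμ Z Y X W ≫ (m₁ ⊗ₘ m₂) := by
  have h : (α_ _ _ _).inv ≫ (α_ Z Y W).hom ▷ X ≫ swapRight Z (Y ⊗ W) X =
      _ ◁ (β_ _ _).hom ≫ tensorμ Z Y X W := by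
    refine Str.eq_of_satG (by repeat first | exact str_swapRight | constructor)
      (by unfold tensorμ; repeat constructor) fun p q => ?_
    simp [tensorμ, exists_col, col_ext]
    grind
  have h2 : (Z ◁ m₂) ▷ X ≫ swapRight Z Y₁ X = swapRight Z (Y ⊗ W) X ≫ (Z ⊗ X) ◁ m₂ := by
    simp only [swapRight, Category.assoc]
    rw [associator_naturality_middle_assoc, ← whiskerLeft_comp_assoc,
      BraidedCategory.braiding_naturality_left, whiskerLeft_comp_assoc, associator_inv_naturality_right]
  rw [← reassoc_of% h, act, actR, actL, comp_whiskerRight, Category.assoc, reassoc_of% h2,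
    whisker_exchange, MonoidalCategory.tensorHom_def]

end action

/-! ## Arrows into atoms -/

section atoms

variable {X Y X₁ X₂ Y₁ Y₂ : SDot V} {x y z w x' y' z' : SDotTerm V}

/-- Composition of arrows into atoms by transitivity. -/
def tcomp (f : X ⟶ le x y) (g : Y ⟶ le y z) : X ⊗ Y ⟶ le x z := (f ⊗ₘ g) ≫ tHom x y z

/-- The operation with a reflexivity on the right. -/
def opLHom (f : X ⟶ le x y) (z : SDotTerm V) : X ⟶ le (.op x z) (.op y z) :=
  (ρ_ X).inv ≫ (f ⊗ₘ rHom z) ≫ aHom x y z z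

/-- The operation with a reflexivity on the left. -/
def opRHom (z : SDotTerm V) (f : X ⟶ le x y) : X ⟶ le (.op z x) (.op z y) :=
  (λ_ X).inv ≫ (rHom z ⊗ₘ f) ≫ aHom z z x y

theorem tensorμ_tensorμ : tensorμ X₁ Y₁ X₂ Y₂ ≫ tensorμ X₁ X₂ Y₁ Y₂ = 𝟙 _ := by
  refine Str.eq_of_satG (by unfold tensorμ; repeat constructor) (by constructor) fun p q => ?_
  simp [tensorμ, exists_col, col_ext]
  grind

/-- The equation (ta) read as an interchange law between transitivity and the operation, using that
`tensorμ` is undone by `tensorμ`. -/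
theorem aHom_tcomp_aHom (f₁ : X₁ ⟶ le x y) (f₂ : X₂ ⟶ le y z) (g₁ : Y₁ ⟶ le x' y')
    (g₂ : Y₂ ⟶ le y' z') :
    tcomp ((f₁ ⊗ₘ g₁) ≫ aHom x y x' y') ((f₂ ⊗ₘ g₂) ≫ aHom y z y' z') =
      tensorμ X₁ Y₁ X₂ Y₂ ≫ (tcomp f₁ f₂ ⊗ₘ tcomp g₁ g₂) ≫ aHom x z x' z' := by
  simp only [tcomp, ← tensorHom_comp_tensorHom, Category.assoc]
  rw [tHom_aHom, ← tensorμ_natural_assoc, reassoc_of% tensorμ_tensorμ]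

theorem rHom_tcomp (f : X ⟶ le x y) : tcomp (rHom x) f = (λ_ X).hom ≫ f := by
  rw [tcomp, MonoidalCategory.tensorHom_def', Category.assoc, rHom_tHom_left,
    leftUnitor_naturality]

theorem tcomp_rHom (f : X ⟶ le x y) : tcomp f (rHom y) = (ρ_ X).hom ≫ f := by
  rw [tcomp, MonoidalCategory.tensorHom_def, Category.assoc, rHom_tHom_right,
    rightUnitor_naturality]

theorem comp_tcomp (h : X₁ ⟶ X) (k : Y₁ ⟶ Y) (f : X ⟶ le x y) (g : Y ⟶ le y z) :
    tcomp (h ≫ f) (k ≫ g) = (h ⊗ₘ k) ≫ tcomp f g := by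
  simp only [tcomp, ← tensorHom_comp_tensorHom, Category.assoc]

theorem opLHom_comp (h : Y ⟶ X) (f : X ⟶ le x y) : opLHom (h ≫ f) z = h ≫ opLHom f z := by
  rw [opLHom, opLHom, reassoc_of% rightUnitor_inv_naturality h, ← tensorHom_id,
    tensorHom_comp_tensorHom_assoc, Category.id_comp]

theorem opRHom_comp (h : Y ⟶ X) (f : X ⟶ le x y) : opRHom z (h ≫ f) = h ≫ opRHom z f := by
  rw [opRHom, opRHom, reassoc_of% leftUnitor_inv_naturality h, ← id_tensorHom,
    tensorHom_comp_tensorHom_assoc, Category.id_comp]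

theorem opLHom_rHom : opLHom (rHom x) y = rHom (.op x y) := by
  rw [← rHom_aHom, opLHom]

theorem opRHom_rHom : opRHom x (rHom y) = rHom (.op x y) := by
  rw [← rHom_aHom, opRHom, unitors_inv_equal]

/-- Interchange in which the second factor is `r` composed with `r`, which is again `r` up to a
unitor. -/
theorem opLHom_tcomp (f : X ⟶ le x y) (g : Y ⟶ le y z) :
    opLHom (tcomp f g) w = tcomp (opLHom f w) (opLHom g w) := by
  have h : ((ρ_ X).inv ⊗ₘ (ρ_ Y).inv) ≫ tensorμ X (𝟙_ _) Y (𝟙_ _) ≫ (X ⊗ Y) ◁ (λ_ _).hom =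
      (ρ_ (X ⊗ Y)).inv := by
    rw [MonoidalCategory.tensorHom_def]
    refine Str.eq_of_satG (by unfold tensorμ; repeat constructor) (by constructor) fun p q => ?_
    simp [tensorμ, exists_col, col_ext, colUnit_ext]
  rw [opLHom, opLHom, opLHom, comp_tcomp, aHom_tcomp_aHom, rHom_tcomp, ← h]
  simp [MonoidalCategory.tensorHom_def']

theorem opRHom_tcomp (f : X ⟶ le x y) (g : Y ⟶ le y z) :
    opRHom w (tcomp f g) = tcomp (opRHom w f) (opRHom w g) := by
  have h : ((λ_ X).inv ⊗ₘ (λ_ Y).inv) ≫ tensorμ (𝟙_ _) X (𝟙_ _) Y ≫ (λ_ _).hom ▷ (X ⊗ Y) =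
      (λ_ (X ⊗ Y)).inv := by
    rw [MonoidalCategory.tensorHom_def]
    refine Str.eq_of_satG (by unfold tensorμ; repeat constructor) (by constructor) fun p q => ?_
    simp [tensorμ, col_ext]
  rw [opRHom, opRHom, opRHom, comp_tcomp, aHom_tcomp_aHom, rHom_tcomp, ← h]
  simp [MonoidalCategory.tensorHom_def]

/-- Interchange with one reflexivity in each factor. Thus `a` can be performed as a change on the
left followed by a change on the right; `tcomp_opRHom_opLHom` gives the other order, at the price of
a braiding. -/
theorem tcomp_opLHom_opRHom (f : X ⟶ le x y) (g : Y ⟶ le z w) :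
    tcomp (opLHom f z) (opRHom y g) = (f ⊗ₘ g) ≫ aHom x y z w := by
  have h : ((ρ_ X).inv ⊗ₘ (λ_ Y).inv) ≫ tensorμ X (𝟙_ _) (𝟙_ _) Y ≫ ((ρ_ X).hom ⊗ₘ (λ_ Y).hom) =
      𝟙 _ := by
    rw [MonoidalCategory.tensorHom_def, MonoidalCategory.tensorHom_def]
    refine Str.eq_of_satG (by unfold tensorμ; repeat constructor) (by constructor) fun p q => ?_
    simp only [tensorμ, satG_comp, satG_whiskerLeft, satG_whiskerRight, satG_assoc_hom,
      satG_assoc_inv, satG_leftUnitor_inv, satG_leftUnitor_hom, satG_rightUnitor_inv,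
      satG_rightUnitor_hom, satG_braiding, satG_id, exists_col, exists_colUnit, cfst_cmk, csnd_cmk,
      col_ext, colUnit_ext]
    grind
  rw [opLHom, opRHom, comp_tcomp, aHom_tcomp_aHom, rHom_tcomp, tcomp_rHom,
    ← tensorHom_comp_tensorHom, Category.assoc, reassoc_of% h]

theorem tcomp_opRHom_opLHom (f : X ⟶ le x y) (g : Y ⟶ le z w) :
    tcomp (opRHom x g) (opLHom f w) = (β_ _ _).hom ≫ (f ⊗ₘ g) ≫ aHom x y z w := by
  have h : ((λ_ Y).inv ⊗ₘ (ρ_ X).inv) ≫ tensorμ (𝟙_ _) Y X (𝟙_ _) ≫ ((λ_ X).hom ⊗ₘ (ρ_ Y).hom) =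
      (β_ Y X).hom := by
    rw [MonoidalCategory.tensorHom_def, MonoidalCategory.tensorHom_def]
    refine Str.eq_of_satG (by unfold tensorμ; repeat constructor) (by constructor) fun p q => ?_
    simp only [tensorμ, satG_comp, satG_whiskerLeft, satG_whiskerRight, satG_assoc_hom,
      satG_assoc_inv, satG_leftUnitor_inv, satG_leftUnitor_hom, satG_rightUnitor_inv,
      satG_rightUnitor_hom, satG_braiding, exists_col, exists_colUnit, cfst_cmk, csnd_cmk,
      col_ext, colUnit_ext]
    grind
  rw [opLHom, opRHom, comp_tcomp, aHom_tcomp_aHom, rHom_tcomp, tcomp_rHom,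
    ← tensorHom_comp_tensorHom, Category.assoc, reassoc_of% h]

/-- The action on atoms by transitivity. -/
def leAct (x : SDotTerm V) (f : X ⟶ le y z) : le x y ⊗ X ⟶ le x z := le x y ◁ f ≫ tHom x y z

theorem leAct_comp (h : Y ⟶ X) (f : X ⟶ le y z) : leAct x (h ≫ f) = le x y ◁ h ≫ leAct x f := by
  simp [leAct]

theorem leAct_rHom : leAct x (rHom y) = (ρ_ (le x y)).hom := rHom_tHom_right x y

/-- Associativity of transitivity, which makes composition of atoms act as two actions in
succession. -/
theorem leAct_tcomp (f : X ⟶ le y z) (g : Y ⟶ le z w) :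
    leAct x (tcomp f g) = act (leAct x f) (leAct x g) := by
  simp only [leAct, tcomp, act, comp_whiskerRight, Category.assoc]
  rw [← whisker_exchange_assoc, tHom_assoc]
  simp [MonoidalCategory.tensorHom_def]

end atoms

/-! ## Replacement in terms -/

/-- `TRep u v x y` is an occurrence of `u` in `x`; the term `y` is obtained from `x` by replacing
that occurrence by `v`. -/
inductive TRep (u v : SDotTerm V) : SDotTerm V → SDotTerm V → Type u
  | here : TRep u v u v
  | opL {x y : SDotTerm V} (T : TRep u v x y) (z : SDotTerm V) : TRep u v (.op x z) (.op y z)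
  | opR {x y : SDotTerm V} (z : SDotTerm V) (T : TRep u v x y) : TRep u v (.op z x) (.op z y)

namespace TRep

variable {u v w x y z : SDotTerm V}

/-- The arrow given by the compatibility of the operation. -/
def map : ∀ {x y : SDotTerm V}, TRep u v x y → (le u v ⟶ le x y)
  | _, _, here => 𝟙 _
  | _, _, opL T z => opLHom T.map z
  | _, _, opR z T => opRHom z T.map

/-- The colouring of the occurrence. -/
def part : ∀ {x y : SDotTerm V}, TRep u v x y → TCol x → TCol u
  | _, _, here, p => p
  | _, _, opL T _, p => T.part (opFst p)
  | _, _, opR _ T, p => T.part (opSnd p)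

/-- The colouring after the replacement. -/
def upd : ∀ {x y : SDotTerm V}, TRep u v x y → TCol x → TCol v → TCol y
  | _, _, here, _, d => d
  | _, _, opL T _, p, d => mkOp (T.upd (opFst p) d) (opSnd p)
  | _, _, opR _ T, p, d => mkOp (opFst p) (T.upd (opSnd p) d)

theorem part_const (T : TRep u v x y) (a : Prop) : T.part (fun _ => a) = fun _ => a := by
  induction T with
  | here => rfl
  | opL T z ih => exact ih
  | opR z T ih => exact ih

theorem occ_le (T : TRep u v x y) : u.occ ≤ x.occ := by
  induction T with
  | here => exact le_rfl
  | opL T z ih => exact ih.trans (Nat.le_add_right _ _)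
  | opR z T ih => exact ih.trans (Nat.le_add_left _ _)

/-- Colourings can be pulled back along a replacement, with the colour of the replaced occurrence
prescribed at will, since the replacement forgets it. -/
theorem exists_upd (T : TRep u v x y) (p : TCol y) (d : TCol u) :
    ∃ q c, T.part q = d ∧ T.upd q c = p := by
  induction T with
  | here => exact ⟨d, p, rfl, rfl⟩
  | opL T z ih =>
    obtain ⟨q, c, h1, h2⟩ := ih (opFst p)
    exact ⟨mkOp q (opSnd p), c, by simp [part, opFst_mk, h1],
      by simp [upd, op_ext, opFst_mk, opSnd_mk, h2]⟩
  | opR z T ih =>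
    obtain ⟨q, c, h1, h2⟩ := ih (opSnd p)
    exact ⟨mkOp (opFst p) q, c, by simp [part, opSnd_mk, h1],
      by simp [upd, op_ext, opFst_mk, opSnd_mk, h2]⟩

theorem satG_map (T : TRep u v x y) (p q) : SatG T.map p q ↔
    T.part (leFst q) = leFst p ∧ leSnd q = T.upd (leFst q) (leSnd p) := by
  induction T with
  | here => simp [map, part, upd, le_ext]; grind
  | opL T z ih =>
    simp [map, part, upd, opLHom, exists_col, ih, satG_rHom, satG_aHom, exists_le,
      leFst_mk, leSnd_mk, op_ext, opFst_mk, opSnd_mk]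
    grind
  | opR z T ih =>
    simp [map, part, upd, opRHom, exists_col, ih, satG_rHom, satG_aHom, exists_le,
      leFst_mk, leSnd_mk, op_ext, opFst_mk, opSnd_mk]
    grind

theorem eq_of_self (T : TRep u u x y) : x = y := by
  induction T with
  | here => rfl
  | opL T z ih => rw [ih]
  | opR z T ih => rw [ih]

/-- Compatibility of the operation with reflexivity (ra), iterated along the context of the
occurrence. The `eqToHom` appears because the replacement of `u` by `u` returns the same term only
up to a proved equality. -/
theorem rHom_map (T : TRep u u x y) (h : x = y) :
    rHom u ≫ T.map = rHom x ≫ eqToHom (congrArg (le x) h) := by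
  induction T with
  | here => simp [map]
  | opL T z ih =>
    obtain rfl := T.eq_of_self
    rw [map, ← opLHom_comp, ih rfl, eqToHom_refl, Category.comp_id, opLHom_rHom, eqToHom_refl,
      Category.comp_id]
  | opR z T ih =>
    obtain rfl := T.eq_of_self
    rw [map, ← opRHom_comp, ih rfl, eqToHom_refl, Category.comp_id, opRHom_rHom, eqToHom_refl,
      Category.comp_id]

/-- The contexts `opLHom` and `opRHom` preserve `tcomp`, so a replacement through `t` passes through
the intermediate term `v` in any context. -/
theorem tHom_map (T : TRep u w x z) (v : SDotTerm V) : ∃ (y : SDotTerm V) (T₁ : TRep u v x y)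
    (T₂ : TRep v w y z), tHom u v w ≫ T.map = tcomp T₁.map T₂.map := by
  induction T with
  | here => exact ⟨v, here, here, by simp [map, tcomp]⟩
  | opL T s ih =>
    obtain ⟨y, T₁, T₂, h⟩ := ih
    exact ⟨_, opL T₁ s, opL T₂ s, by simp only [map, ← opLHom_comp, ← opLHom_tcomp, h]⟩
  | opR s T ih =>
    obtain ⟨y, T₁, T₂, h⟩ := ih
    exact ⟨_, opR s T₁, opR s T₂, by simp only [map, ← opRHom_comp, ← opRHom_tcomp, h]⟩

/-- At the occurrence itself the left component is replaced before the right one, by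
`tcomp_opLHom_opRHom`; the surrounding context preserves the composite. -/
theorem aHom_map {u₁ v₁ u₂ v₂ : SDotTerm V} (T : TRep (.op u₁ u₂) (.op v₁ v₂) x z) :
    ∃ (y : SDotTerm V) (T₁ : TRep u₁ v₁ x y) (T₂ : TRep u₂ v₂ y z),
      aHom u₁ v₁ u₂ v₂ ≫ T.map = tcomp T₁.map T₂.map := by
  induction T with
  | here =>
    exact ⟨_, opL here _, opR _ here, by simp only [map, tcomp_opLHom_opRHom]; simp⟩
  | opL T s ih =>
    obtain ⟨y, T₁, T₂, h⟩ := ih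
    exact ⟨_, opL T₁ s, opL T₂ s, by simp only [map, ← opLHom_comp, ← opLHom_tcomp, h]⟩
  | opR s T ih =>
    obtain ⟨y, T₁, T₂, h⟩ := ih
    exact ⟨_, opR s T₁, opR s T₂, by simp only [map, ← opRHom_comp, ← opRHom_tcomp, h]⟩

theorem eq_of_part {y₁ y₂ : SDotTerm V} (T₁ : TRep u v x y₁) (T₂ : TRep u v x y₂)
    (h : ∀ p, T₁.part p = T₂.part p) : (⟨y₁, T₁⟩ : Σ y, TRep u v x y) = ⟨y₂, T₂⟩ := by
  -- Colouring the two operands by `True` and `False` tells their occurrences apart.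
  have clash : ∀ {x y z w : SDotTerm V} (T : TRep u v x y) (S : TRep u v z w),
      ¬ ∀ p : TCol (.op x z), T.part (opFst p) = S.part (opSnd p) := by
    intro x y z w T S h
    have h1 := h (mkOp (fun _ => True) fun _ => False)
    rw [opFst_mk, opSnd_mk, part_const, part_const] at h1
    exact const_ne h1
  -- A whole term cannot occur in one of its own proper subterms, which has fewer occurrences of
  -- variables.
  have hlt : ∀ {x z : SDotTerm V}, ¬ (SDotTerm.op x z).occ ≤ x.occ ∧ ¬ (SDotTerm.op z x).occ ≤ x.occ := by
    intro x z
    have := occ_pos z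
    simp only [SDotTerm.occ]
    omega
  induction T₁ generalizing y₂ with
  | here =>
    cases T₂ with
    | here => rfl
    | opL T₂ z => exact absurd T₂.occ_le hlt.1
    | opR z T₂ => exact absurd T₂.occ_le hlt.2
  | opL T₁ z ih =>
    cases T₂ with
    | here => exact absurd T₁.occ_le hlt.1
    | opL T₂ z =>
      cases ih T₂ fun p => by simpa [part, opFst_mk] using h (mkOp p fun _ => True)
      rfl
    | opR z T₂ => exact absurd h (clash T₁ T₂)
  | opR z T₁ ih =>
    cases T₂ with
    | here => exact absurd T₁.occ_le hlt.2
    | opL T₂ z => exact absurd (fun p => (h p).symm) (clash T₂ T₁)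
    | opR z T₂ =>
      cases ih T₂ fun p => by simpa [part, opSnd_mk] using h (mkOp (fun _ => True) p)
      rfl

/-- The hypothesis expresses disjointness of the two occurrences: nested or equal ones could not be
coloured by opposite constants. Disjoint occurrences part ways at some operation, where the two
decompositions of `a` give commutation. The last clause says that `T'` is the occurrence of `T`
after the other replacement. -/
theorem exists_commute {u' v' y' : SDotTerm V} (T : TRep u v x y) (S : TRep u' v' x y')
    (h : ∃ p, T.part p = (fun _ => True) ∧ S.part p = fun _ => False) :
    ∃ (w : SDotTerm V) (S' : TRep u' v' y w) (T' : TRep u v y' w),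
      tcomp T.map S'.map = (β_ _ _).hom ≫ tcomp S.map T'.map ∧
        ∀ p c, T'.part (S.upd p c) = T.part p := by
  induction T generalizing y' with
  | here =>
    obtain ⟨p, rfl, h⟩ := h
    rw [part_const] at h
    exact absurd h const_ne
  | opL T z ih =>
    cases S with
    | here =>
      obtain ⟨p, h, rfl⟩ := h
      exact absurd ((T.part_const _).symm.trans h).symm const_ne
    | opL S z =>
      obtain ⟨p, h⟩ := h
      obtain ⟨w, S', T', h1, h2⟩ := ih S ⟨_, h⟩
      refine ⟨_, opL S' z, opL T' z, ?_, fun p c => ?_⟩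
      · simp only [map, ← opLHom_tcomp, h1, opLHom_comp]
      · simp [part, upd, opFst_mk, h2]
    | opR z S =>
      refine ⟨_, opR _ S, opL T _, ?_, fun p c => ?_⟩
      · simp only [map, tcomp_opLHom_opRHom, tcomp_opRHom_opLHom,
          SymmetricCategory.symmetry_assoc]
      · simp [part, upd, opFst_mk]
  | opR z T ih =>
    cases S with
    | here =>
      obtain ⟨p, h, rfl⟩ := h
      exact absurd ((T.part_const _).symm.trans h).symm const_ne
    | opL S z =>
      refine ⟨_, opL S _, opR _ T, ?_, fun p c => ?_⟩
      · simp only [map, tcomp_opLHom_opRHom, tcomp_opRHom_opLHom]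
      · simp [part, upd, opSnd_mk]
    | opR z S =>
      obtain ⟨p, h⟩ := h
      obtain ⟨w, S', T', h1, h2⟩ := ih S ⟨_, h⟩
      refine ⟨_, opR z S', opR z T', ?_, fun p c => ?_⟩
      · simp only [map, ← opRHom_tcomp, h1, opRHom_comp]
      · simp [part, upd, opSnd_mk, h2]

end TRep

/-! ## Replacement in formulae -/

/-- `ZRep u v Z Z'` is an occurrence of `u` in the right-hand side of an atom of `Z`; the formula
`Z'` is obtained from `Z` by replacing that occurrence by `v`. -/
inductive ZRep (u v : SDotTerm V) : SDot V → SDot V → Type u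
  | le (x : SDotTerm V) {y z : SDotTerm V} (T : TRep u v y z) : ZRep u v (le x y) (le x z)
  | andL {Z Z' : SDot V} (S : ZRep u v Z Z') (Y : SDot V) : ZRep u v (Z ⊗ Y) (Z' ⊗ Y)
  | andR {Z Z' : SDot V} (Y : SDot V) (S : ZRep u v Z Z') : ZRep u v (Y ⊗ Z) (Y ⊗ Z')

namespace ZRep

variable {u v w : SDotTerm V} {Z Z₁ Z₂ : SDot V}

/-- The arrow given by transitivity. -/
def map : ∀ {Z Z' : SDot V}, ZRep u v Z Z' → (Z ⊗ SDot.le u v ⟶ Z')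
  | _, _, le x T => leAct x T.map
  | _, _, andL S Y => actL Y S.map
  | _, _, andR Y S => actR Y S.map

/-- The colouring of the occurrence. -/
def part : ∀ {Z Z' : SDot V}, ZRep u v Z Z' → Col Z → TCol u
  | _, _, le _ T, p => T.part (leSnd p)
  | _, _, andL S _, p => S.part (cfst p)
  | _, _, andR _ S, p => S.part (csnd p)

/-- The colouring after the replacement. -/
def upd : ∀ {Z Z' : SDot V}, ZRep u v Z Z' → Col Z → TCol v → Col Z'
  | _, _, le _ T, p, d => mkLe (leFst p) (T.upd (leSnd p) d)
  | _, _, andL S _, p, d => cmk (S.upd (cfst p) d) (csnd p)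
  | _, _, andR _ S, p, d => cmk (cfst p) (S.upd (csnd p) d)

theorem part_const (S : ZRep u v Z Z₁) (a : Prop) : S.part (fun _ => a) = fun _ => a := by
  induction S with
  | le x T => exact T.part_const a
  | andL S Y ih => exact ih
  | andR Y S ih => exact ih

theorem exists_upd (S : ZRep u v Z Z₁) (p : Col Z₁) (d : TCol u) :
    ∃ q c, S.part q = d ∧ S.upd q c = p := by
  induction S with
  | le x T =>
    obtain ⟨q, c, h1, h2⟩ := T.exists_upd (leSnd p) d
    exact ⟨mkLe (leFst p) q, c, by simp [part, leSnd_mk, h1],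
      by simp [upd, le_ext, leFst_mk, leSnd_mk, h2]⟩
  | andL S Y ih =>
    obtain ⟨q, c, h1, h2⟩ := ih (cfst p)
    exact ⟨cmk q (csnd p), c, by simp [part, h1], by simp [upd, col_ext, h2]⟩
  | andR Y S ih =>
    obtain ⟨q, c, h1, h2⟩ := ih (csnd p)
    exact ⟨cmk (cfst p) q, c, by simp [part, h1], by simp [upd, col_ext, h2]⟩

theorem satG_map (S : ZRep u v Z Z₁) (p q) : SatG S.map p q ↔
    S.part (cfst p) = leFst (csnd p) ∧ q = S.upd (cfst p) (leSnd (csnd p)) := by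
  induction S with
  | le x T =>
    simp [map, part, upd, leAct, exists_col, satG_tHom, TRep.satG_map, exists_le, le_ext,
      leFst_mk, leSnd_mk]
    grind
  | andL S Y ih =>
    simp [map, part, upd, actL, exists_col, ih, col_ext]
    grind
  | andR Y S ih =>
    simp [map, part, upd, actR, exists_col, ih, col_ext]
    grind

theorem eq_of_self (S : ZRep u u Z Z₁) : Z = Z₁ := by
  induction S with
  | le x T => rw [T.eq_of_self]
  | andL S Y ih => rw [ih]
  | andR Y S ih => rw [ih]

theorem rHom_map (S : ZRep u u Z Z₁) (h : Z = Z₁) :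
    Z ◁ rHom u ≫ S.map = (ρ_ Z).hom ≫ eqToHom h := by
  induction S with
  | le x T =>
    obtain rfl := T.eq_of_self
    rw [map, ← leAct_comp, T.rHom_map rfl, eqToHom_refl, Category.comp_id, leAct_rHom,
      eqToHom_refl, Category.comp_id]
  | andL S Y ih =>
    obtain rfl := S.eq_of_self
    rw [map, ← actL_whiskerLeft, ih rfl, eqToHom_refl, Category.comp_id, actL_rightUnitor,
      eqToHom_refl, Category.comp_id]
  | andR Y S ih =>
    obtain rfl := S.eq_of_self
    rw [map, ← actR_whiskerLeft, ih rfl, eqToHom_refl, Category.comp_id, actR_rightUnitor,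
      eqToHom_refl, Category.comp_id]

/-- The splitting inside an atom is lifted through conjunctions, since `leAct`, `actL` and `actR`
all turn composites into successive actions. -/
theorem tHom_map (S : ZRep u w Z Z₂) (v : SDotTerm V) : ∃ (Z₁ : SDot V) (S₁ : ZRep u v Z Z₁)
    (S₂ : ZRep v w Z₁ Z₂), Z ◁ tHom u v w ≫ S.map = act S₁.map S₂.map := by
  induction S with
  | le x T =>
    obtain ⟨y, T₁, T₂, h⟩ := T.tHom_map v
    exact ⟨_, le x T₁, le x T₂, by simp only [map, ← leAct_comp, h, leAct_tcomp]⟩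
  | andL S Y ih =>
    obtain ⟨y, T₁, T₂, h⟩ := ih
    exact ⟨_, andL T₁ Y, andL T₂ Y, by simp only [map, ← actL_whiskerLeft, h, actL_act]⟩
  | andR Y S ih =>
    obtain ⟨y, T₁, T₂, h⟩ := ih
    exact ⟨_, andR Y T₁, andR Y T₂, by simp only [map, ← actR_whiskerLeft, h, actR_act]⟩

theorem aHom_map {u₁ v₁ u₂ v₂ : SDotTerm V} (S : ZRep (.op u₁ u₂) (.op v₁ v₂) Z Z₂) :
    ∃ (Z₁ : SDot V) (S₁ : ZRep u₁ v₁ Z Z₁) (S₂ : ZRep u₂ v₂ Z₁ Z₂),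
      Z ◁ aHom u₁ v₁ u₂ v₂ ≫ S.map = act S₁.map S₂.map := by
  induction S with
  | le x T =>
    obtain ⟨y, T₁, T₂, h⟩ := T.aHom_map
    exact ⟨_, le x T₁, le x T₂, by simp only [map, ← leAct_comp, h, leAct_tcomp]⟩
  | andL S Y ih =>
    obtain ⟨y, T₁, T₂, h⟩ := ih
    exact ⟨_, andL T₁ Y, andL T₂ Y, by simp only [map, ← actL_whiskerLeft, h, actL_act]⟩
  | andR Y S ih =>
    obtain ⟨y, T₁, T₂, h⟩ := ih
    exact ⟨_, andR Y T₁, andR Y T₂, by simp only [map, ← actR_whiskerLeft, h, actR_act]⟩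

theorem eq_of_part (S₁ : ZRep u v Z Z₁) (S₂ : ZRep u v Z Z₂)
    (h : ∀ p, S₁.part p = S₂.part p) : (⟨Z₁, S₁⟩ : Σ Z', ZRep u v Z Z') = ⟨Z₂, S₂⟩ := by
  have clash : ∀ {Z Z₁ Y Y₁ : SDot V} (T : ZRep u v Z Z₁) (S : ZRep u v Y Y₁),
      ¬ ∀ p : Col (Z ⊗ Y), T.part (cfst p) = S.part (csnd p) := by
    intro x y z w T S h
    have h1 := h (cmk (fun _ => True) fun _ => False)
    rw [cfst_cmk, csnd_cmk, part_const, part_const] at h1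
    exact const_ne h1
  induction S₁ generalizing Z₂ with
  | le x T₁ =>
    cases S₂ with
    | le x T₂ =>
      cases T₁.eq_of_part T₂ fun p => by simpa [part, leSnd_mk] using h (mkLe (fun _ => True) p)
      rfl
  | andL S₁ Y ih =>
    cases S₂ with
    | andL S₂ Y =>
      cases ih S₂ fun p => by simpa [part] using h (cmk p fun _ => True)
      rfl
    | andR Y S₂ => exact absurd h (clash S₁ S₂)
  | andR Y S₁ ih =>
    cases S₂ with
    | andL S₂ Y => exact absurd (fun p => (h p).symm) (clash S₂ S₁)
    | andR Y S₂ =>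
      cases ih S₂ fun p => by simpa [part] using h (cmk (fun _ => True) p)
      rfl

theorem exists_commute {u' v' : SDotTerm V} (T : ZRep u v Z Z₁) (S : ZRep u' v' Z Z₂)
    (h : ∃ p, T.part p = (fun _ => True) ∧ S.part p = fun _ => False) :
    ∃ (W : SDot V) (S' : ZRep u' v' Z₁ W) (T' : ZRep u v Z₂ W),
      act T.map S'.map = Z ◁ (β_ _ _).hom ≫ act S.map T'.map ∧
        ∀ p c, T'.part (S.upd p c) = T.part p := by
  induction T generalizing Z₂ with
  | le x T =>
    cases S with
    | le x S =>
      obtain ⟨p, h⟩ := h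
      obtain ⟨w, S', T', h1, h2⟩ := T.exists_commute S ⟨_, h⟩
      refine ⟨_, le x S', le x T', ?_, fun p c => ?_⟩
      · simp only [map, ← leAct_tcomp, h1, leAct_comp]
      · simp [part, upd, leSnd_mk, h2]
  | andL T Y ih =>
    cases S with
    | andL S Y =>
      obtain ⟨p, h⟩ := h
      obtain ⟨w, S', T', h1, h2⟩ := ih S ⟨_, h⟩
      refine ⟨_, andL S' Y, andL T' Y, ?_, fun p c => ?_⟩
      · simp only [map, ← actL_act, h1, actL_whiskerLeft]
      · simp [part, upd, h2]
    | andR Y S =>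
      -- The occurrences lie in different conjuncts, so the actions commute by the monoidal
      -- structure alone.
      refine ⟨_, andR _ S, andL T _, ?_, fun p c => ?_⟩
      · simp only [map, act_actL_actR, act_actR_actL]
        rw [← whiskerLeft_comp_assoc, SymmetricCategory.symmetry, whiskerLeft_id, Category.id_comp]
      · simp [part, upd]
  | andR Y T ih =>
    cases S with
    | andL S Y =>
      refine ⟨_, andL S _, andR _ T, ?_, fun p c => ?_⟩
      · simp only [map, act_actL_actR, act_actR_actL]
      · simp [part, upd]
    | andR Y S =>
      obtain ⟨p, h⟩ := h
      obtain ⟨w, S', T', h1, h2⟩ := ih S ⟨_, h⟩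
      refine ⟨_, andR Y S', andR Y T', ?_, fun p c => ?_⟩
      · simp only [map, ← actR_act, h1, actR_whiskerLeft]
      · simp [part, upd, h2]

end ZRep

/-! ## Actions of extracted conjuncts -/

section extAct

variable {X Y Z Z₁ Z₂ W A A₁ B B₁ D : SDot V}

/-- The action of an extracted conjunct. -/
def extAct (m : Z ⊗ X ⟶ Z₁) (e : Ext X A A₁) : Z ⊗ A ⟶ Z₁ ⊗ A₁ :=
  Z ◁ e.iso.hom ≫ (α_ _ _ _).inv ≫ m ▷ A₁

/-- The case of an atom that passes through `f` unchanged: the action is performed before the rest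
of `f`. -/
theorem whiskerLeft_extAct (m : Z ⊗ X ⟶ Z₁) {f : A ⟶ B} {e : Ext X B B₁} {e' : Ext X A A₁}
    {f' : A₁ ⟶ B₁} (h : f ≫ e.iso.hom = e'.iso.hom ≫ X ◁ f') :
    Z ◁ f ≫ extAct m e = extAct m e' ≫ Z₁ ◁ f' := by
  simp only [extAct, Category.assoc]
  rw [← whiskerLeft_comp_assoc, h, whiskerLeft_comp_assoc, ← whisker_exchange,
    associator_inv_naturality_right_assoc]

theorem whiskerLeft_extAct_core (m : Z ⊗ X ⟶ Z₁) {f : A ⟶ B} {e : Ext X B B₁} {g : Y ⟶ X}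
    {e' : Ext Y A B₁} (h : f ≫ e.iso.hom = e'.iso.hom ≫ g ▷ B₁) :
    Z ◁ f ≫ extAct m e = extAct (Z ◁ g ≫ m) e' := by
  simp only [extAct]
  rw [← whiskerLeft_comp_assoc, h]
  simp

theorem extAct_rightUnitor (e : Ext (𝟙_ (SDot V)) A A₁) :
    extAct (ρ_ Z).hom e = Z ◁ (e.iso.hom ≫ (λ_ A₁).hom) := by
  simp [extAct]

/-- Extracting `X ⊗ Y` leaves one `⊤` behind, whereas extracting `X` and then `Y` leaves `⊤ ∧ ⊤`.
The arrow `s` repairs this difference. -/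
theorem Ext.exists_split (e : Ext (X ⊗ Y) A A₁) : ∃ (A₂ A₃ : SDot V) (e₁ : Ext X A A₂)
    (e₂ : Ext Y A₂ A₃) (s : A₃ ⟶ A₁), Str s ∧
      e.iso.hom = e₁.iso.hom ≫ X ◁ (e₂.iso.hom ≫ Y ◁ s) ≫ (α_ _ _ _).inv := by
  -- The equation is between structural arrows, so it is enough to construct the data together with
  -- their effect on colourings.
  suffices h : ∃ (A₂ A₃ : SDot V) (e₁ : Ext X A A₂) (e₂ : Ext Y A₂ A₃) (s : A₃ ⟶ A₁), Str s ∧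
      ∀ p, e₁.part p = cfst (e.part p) ∧ e₂.part (e₁.rest p) = csnd (e.part p) ∧
        ∀ q, SatG s (e₂.rest (e₁.rest p)) q ↔ q = e.rest p by
    obtain ⟨A₂, A₃, e₁, e₂, s, hs, h⟩ := h
    refine ⟨A₂, A₃, e₁, e₂, s, hs, ?_⟩
    refine Str.eq_of_satG e.str (by repeat first | exact Ext.str _ | exact hs | constructor) ?_
    intro p q
    simp [exists_col, SDot.col_ext]
    grind
  induction e with
  | here =>
    exact ⟨_, _, .left .here _, .right _ .here, (λ_ _).hom, .leftUnitor_hom _,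
      fun p => ⟨rfl, by simp [Ext.part, Ext.rest], fun q =>
        iff_of_true ((satG_leftUnitor_hom _ _).2 (Subsingleton.elim _ _)) (Subsingleton.elim _ _)⟩⟩
  | left e D ih =>
    obtain ⟨A₂, A₃, e₁, e₂, s, hs, h⟩ := ih
    refine ⟨_, _, e₁.left D, e₂.left D, s ▷ D, hs.whiskerRight D, fun p => ?_⟩
    simp [Ext.part, Ext.rest, h, SDot.col_ext]
    grind
  | right D e ih =>
    obtain ⟨A₂, A₃, e₁, e₂, s, hs, h⟩ := ih
    refine ⟨_, _, e₁.right D, e₂.right D, D ◁ s, hs.whiskerLeft D, fun p => ?_⟩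
    simp [Ext.part, Ext.rest, h, SDot.col_ext]
    grind

theorem extAct_act (m₁ : Z ⊗ X ⟶ Z₁) (m₂ : Z₁ ⊗ Y ⟶ Z₂) {A₂ A₃ : SDot V} {e : Ext (X ⊗ Y) A A₁}
    {e₁ : Ext X A A₂} {e₂ : Ext Y A₂ A₃} {s : A₃ ⟶ A₁}
    (h : e.iso.hom = e₁.iso.hom ≫ X ◁ (e₂.iso.hom ≫ Y ◁ s) ≫ (α_ _ _ _).inv) :
    extAct (act m₁ m₂) e = extAct m₁ e₁ ≫ extAct m₂ e₂ ≫ Z₂ ◁ s := by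
  simp only [extAct, act, h, Category.assoc]
  rw [← whisker_exchange, ← associator_inv_naturality_right_assoc, ← whiskerLeft_comp_assoc,
    ← whisker_exchange_assoc]
  simp

end extAct

/-! ## Runs -/

/-- Arrows to `B` that use up the atoms of the second conjunct of the source one after another, in
order to transform the first conjunct into `B`. -/
inductive Run {B : SDot V} : ∀ {Z A : SDot V}, (Z ⊗ A ⟶ B) → Prop
  | done {A : SDot V} (hA : Triv A) : Run (B ◁ (trivIso hA).hom ≫ (ρ_ B).hom)
  | step {u v : SDotTerm V} {Z Z₁ A A₁ : SDot V} (S : ZRep u v Z Z₁) (e : Ext (le u v) A A₁)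
      {h : Z₁ ⊗ A₁ ⟶ B} : Run h → Run (extAct S.map e ≫ h)

/-- The primitive arrows into atoms. -/
inductive Core : ∀ {X : SDot V} {x y : SDotTerm V}, (X ⟶ le x y) → Prop
  | r (x : SDotTerm V) : Core (rHom x)
  | t (x y z : SDotTerm V) : Core (tHom x y z)
  | a (x y z w : SDotTerm V) : Core (aHom x y z w)

/-- The primitive arrows into atoms, conjoined with identity arrows. -/
inductive Gen : ∀ {A B : SDot V}, (A ⟶ B) → Prop
  | core {X : SDot V} {x y : SDotTerm V} {g : X ⟶ le x y} : Core g → Gen g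
  | whiskerLeft (C : SDot V) {A B : SDot V} {f : A ⟶ B} : Gen f → Gen (C ◁ f)
  | whiskerRight {A B : SDot V} {f : A ⟶ B} (C : SDot V) : Gen f → Gen (f ▷ C)

theorem Gen.not_triv {A B : SDot V} {f : A ⟶ B} (h : Gen f) : ¬ Triv B := by
  induction h with
  | core => exact id
  | whiskerLeft C _ ih => exact fun h => ih h.snd
  | whiskerRight C _ ih => exact fun h => ih h.fst

/-- An atom of the target either passes through unchanged or is the one that the primitive arrow
produces; in the latter case its source is a conjunct of `A`. -/
theorem Gen.extract {A B : SDot V} {f : A ⟶ B} (h : Gen f) {x y : SDotTerm V} {B₁ : SDot V}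
    (e : Ext (le x y) B B₁) :
    (∃ (A₁ : SDot V) (e' : Ext (le x y) A A₁) (f' : A₁ ⟶ B₁),
      Gen f' ∧ f ≫ e.iso.hom = e'.iso.hom ≫ le x y ◁ f') ∨
    ∃ (X : SDot V) (e' : Ext X A B₁) (g : X ⟶ le x y),
      Core g ∧ f ≫ e.iso.hom = e'.iso.hom ≫ g ▷ B₁ := by
  induction h generalizing B₁ with
  | core hg =>
    cases e
    exact .inr ⟨_, .here, _, hg, by simp [Ext.here_hom]⟩
  | whiskerLeft C s ih =>
    cases e with
    | left e D =>
      refine .inl ⟨_, .left e _, _, .whiskerLeft _ s, ?_⟩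
      simp [Ext.left_hom, whisker_exchange_assoc]
    | right D e =>
      rcases ih e with ⟨_, e1, f1, s1, h1⟩ | ⟨_, e1, f1, s1, h1⟩
      · refine .inl ⟨_, .right _ e1, _ ◁ f1, .whiskerLeft _ s1, ?_⟩
        simp only [Ext.right_hom, ← whiskerLeft_comp_assoc, h1]
        simp only [whiskerLeft_comp, Category.assoc, associator_inv_naturality_right_assoc,
          whisker_exchange_assoc, associator_naturality_right]
      · refine .inr ⟨_, .right _ e1, f1, s1, ?_⟩
        simp only [Ext.right_hom, ← whiskerLeft_comp_assoc, h1]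
        rw [whiskerLeft_comp_assoc, associator_inv_naturality_middle_assoc,
          ← comp_whiskerRight_assoc, BraidedCategory.braiding_naturality_right]
        simp
  | whiskerRight C s ih =>
    cases e with
    | left e D =>
      rcases ih e with ⟨_, e1, f1, s1, h1⟩ | ⟨_, e1, f1, s1, h1⟩
      · refine .inl ⟨_, .left e1 _, f1 ▷ _, .whiskerRight _ s1, ?_⟩
        simp only [Ext.left_hom, ← comp_whiskerRight_assoc, h1]
        simp
      · refine .inr ⟨_, .left e1 _, f1, s1, ?_⟩
        simp only [Ext.left_hom, ← comp_whiskerRight_assoc, h1]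
        simp
    | right D e =>
      refine .inl ⟨_, .right _ e, _, .whiskerRight _ s, ?_⟩
      rw [Ext.right_hom, ← whisker_exchange_assoc, associator_inv_naturality_left_assoc,
        ← comp_whiskerRight_assoc, BraidedCategory.braiding_naturality_left]
      simp [Ext.right_hom]

/-! ### Closure of runs under precomposition -/

/-- Each atom used by the run is traced back through the structural arrow, so the same replacements
are made with relocated atoms. -/
theorem Run.comp_str {Z A A' B : SDot V} {h : Z ⊗ A' ⟶ B} (hh : Run h) {f : A ⟶ A'}
    (hf : Str f) : Run (Z ◁ f ≫ h) := by
  induction hh generalizing A with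
  | done hA =>
    obtain ⟨hA', e⟩ := hf.triv hA
    rw [← whiskerLeft_comp_assoc, e]
    exact .done hA'
  | step S e _ ih =>
    obtain ⟨_, e', f', hf', he⟩ := hf.extract e
    rw [← Category.assoc, whiskerLeft_extAct _ he, Category.assoc]
    exact .step S e' (ih hf')

/-- The step whose atom is produced by `g` is rewritten: it vanishes for `r` and becomes two steps
for `t` and `a`. Structural corrections are absorbed by the rest of the run. -/
theorem Run.extAct_core {X Z Z₁ A A₁ B : SDot V} {x y : SDotTerm V} {g : X ⟶ le x y} (hg : Core g)
    (S : ZRep x y Z Z₁) (e : Ext X A A₁) {h : Z₁ ⊗ A₁ ⟶ B} (hh : Run h) :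
    Run (extAct (Z ◁ g ≫ S.map) e ≫ h) := by
  cases hg with
  | r x =>
    obtain rfl := S.eq_of_self
    rw [S.rHom_map rfl, eqToHom_refl, Category.comp_id, extAct_rightUnitor]
    exact hh.comp_str (e.str.comp (.leftUnitor_hom _))
  | t x y z =>
    obtain ⟨Z', S₁, S₂, hS⟩ := S.tHom_map y
    obtain ⟨A₂, A₃, e₁, e₂, s, hs, he⟩ := e.exists_split
    rw [hS, extAct_act _ _ he, Category.assoc, Category.assoc]
    exact .step S₁ e₁ (.step S₂ e₂ (hh.comp_str hs))
  | a x y z w =>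
    obtain ⟨Z', S₁, S₂, hS⟩ := S.aHom_map
    obtain ⟨A₂, A₃, e₁, e₂, s, hs, he⟩ := e.exists_split
    rw [hS, extAct_act _ _ he, Category.assoc, Category.assoc]
    exact .step S₁ e₁ (.step S₂ e₂ (hh.comp_str hs))

theorem Run.comp_gen {Z A A' B : SDot V} {h : Z ⊗ A' ⟶ B} (hh : Run h) {f : A ⟶ A'}
    (hf : Gen f) : Run (Z ◁ f ≫ h) := by
  induction hh generalizing A with
  -- A finished run has no atoms left in `A'`, but a generator always produces one.
  | done hA => exact absurd hA hf.not_triv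
  | step S e hh ih =>
    rw [← Category.assoc]
    rcases hf.extract e with ⟨_, e', f', hf', he⟩ | ⟨_, e', g, hg, he⟩
    · rw [whiskerLeft_extAct _ he, Category.assoc]
      exact .step S e' (ih hf')
    · rw [whiskerLeft_extAct_core _ he]
      exact hh.extAct_core hg S e'

/-- Composites of structural arrows and primitive arrows conjoined with identity arrows. -/
inductive Fac : ∀ {A B : SDot V}, (A ⟶ B) → Prop
  | str {A B : SDot V} {f : A ⟶ B} : Str f → Fac f
  | gen {A B : SDot V} {f : A ⟶ B} : Gen f → Fac f
  | comp {A B C : SDot V} {f : A ⟶ B} {g : B ⟶ C} : Fac f → Fac g → Fac (f ≫ g)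

theorem Fac.whiskerLeft (C : SDot V) {A B : SDot V} {f : A ⟶ B} (h : Fac f) : Fac (C ◁ f) := by
  induction h with
  | str h => exact .str (h.whiskerLeft C)
  | gen h => exact .gen (h.whiskerLeft C)
  | comp _ _ ih1 ih2 =>
    rw [whiskerLeft_comp]
    exact ih1.comp ih2

theorem Fac.whiskerRight {A B : SDot V} {f : A ⟶ B} (C : SDot V) (h : Fac f) : Fac (f ▷ C) := by
  induction h with
  | str h => exact .str (h.whiskerRight C)
  | gen h => exact .gen (h.whiskerRight C)
  | comp _ _ ih1 ih2 =>
    rw [comp_whiskerRight]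
    exact ih1.comp ih2

theorem fac {A B : SDot V} (f : A ⟶ B) : Fac f := by
  obtain ⟨f, rfl⟩ := exists_hom f
  induction f with
  | one A => exact .str (.id A)
  | bTo A B C => exact .str (.assoc_inv A B C)
  | bFrom A B C => exact .str (.assoc_hom A B C)
  | deltaTo A => exact .str (.rightUnitor_hom A)
  | deltaFrom A => exact .str (.rightUnitor_inv A)
  | sigmaTo A => exact .str (.leftUnitor_hom A)
  | sigmaFrom A => exact .str (.leftUnitor_inv A)
  | c A B => exact .str (.braiding A B)
  | r x => exact .gen (.core (.r x))
  | t x y z => exact .gen (.core (.t x y z))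
  | a x y z w => exact .gen (.core (.a x y z w))
  | wedge f g ih1 ih2 =>
    rw [hom_wedge, MonoidalCategory.tensorHom_def]
    exact (ih1.whiskerRight _).comp (ih2.whiskerLeft _)
  | comp g f ih1 ih2 => exact ih2.comp ih1

theorem Run.comp {Z A A' B : SDot V} {h : Z ⊗ A' ⟶ B} (hh : Run h) (f : A ⟶ A') :
    Run (Z ◁ f ≫ h) := by
  have hf := fac f
  induction hf with
  | str hf => exact hh.comp_str hf
  | gen hf => exact hh.comp_gen hf
  | comp _ _ ih1 ih2 =>
    rw [whiskerLeft_comp, Category.assoc]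
    exact ih1 (ih2 hh)

/-! ## The identity arrow as a run -/

/-- Moves `tensorμ` past a step in the first factor, so that this step of one run becomes a step of
the conjunction of two runs. -/
theorem extAct_left_tensorμ {X Z Z₁ Y A A₁ D : SDot V} (m : Z ⊗ X ⟶ Z₁) (e : Ext X A A₁) :
    extAct (actL Y m) (e.left D) ≫ tensorμ Z₁ Y A₁ D =
      tensorμ Z Y A D ≫ extAct m e ▷ (Y ⊗ D) := by
  have h : (Z ⊗ Y) ◁ (α_ X A₁ D).hom ≫ (α_ _ _ _).inv ≫ swapRight Z Y X ▷ (A₁ ⊗ D) ≫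
      tensorμ (Z ⊗ X) Y A₁ D = tensorμ Z Y (X ⊗ A₁) D ≫ (α_ Z X A₁).inv ▷ (Y ⊗ D) := by
    refine Str.eq_of_satG
      (by unfold tensorμ; repeat first | exact str_swapRight | constructor)
      (by unfold tensorμ; repeat constructor) fun p q => ?_
    simp only [tensorμ, satG_comp, satG_whiskerLeft, satG_whiskerRight, satG_assoc_hom,
      satG_assoc_inv, satG_braiding, exists_col, cfst_cmk, csnd_cmk, col_ext, satG_swapRight]
    grind
  have h1 := tensorμ_natural_left m (𝟙 Y) A₁ D
  have h2 := tensorμ_natural_right Z Y e.iso.hom (𝟙 D)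
  rw [tensorHom_id, id_whiskerRight, tensorHom_id] at h1
  rw [tensorHom_id, whiskerLeft_id, tensorHom_id] at h2
  simp only [extAct, actL, Ext.left_hom, comp_whiskerRight, whiskerLeft_comp, Category.assoc]
  rw [h1, reassoc_of% h, reassoc_of% h2]

theorem extAct_right_tensorμ {X Z Z₁ Y A A₁ D : SDot V} (m : Z ⊗ X ⟶ Z₁) (e : Ext X A A₁) :
    extAct (actR Y m) (e.right D) ≫ tensorμ Y Z₁ D A₁ =
      tensorμ Y Z D A ≫ (Y ⊗ D) ◁ extAct m e := by
  have h : (Y ⊗ Z) ◁ ((α_ _ _ _).inv ≫ (β_ D X).hom ▷ A₁ ≫ (α_ _ _ _).hom) ≫ (α_ _ _ _).inv ≫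
      (α_ Y Z X).hom ▷ (D ⊗ A₁) ≫ tensorμ Y (Z ⊗ X) D A₁ =
        tensorμ Y Z D (X ⊗ A₁) ≫ (Y ⊗ D) ◁ (α_ Z X A₁).inv := by
    refine Str.eq_of_satG
      (by unfold tensorμ; repeat constructor)
      (by unfold tensorμ; repeat constructor) fun p q => ?_
    simp only [tensorμ, satG_comp, satG_whiskerLeft, satG_whiskerRight, satG_assoc_hom,
      satG_assoc_inv, satG_braiding, exists_col, cfst_cmk, csnd_cmk, col_ext]
    grind
  have h1 := tensorμ_natural_left (𝟙 Y) m D A₁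
  have h2 := tensorμ_natural_right Y Z (𝟙 D) e.iso.hom
  rw [id_tensorHom, id_whiskerRight, id_tensorHom] at h1
  rw [id_tensorHom, whiskerLeft_id, id_tensorHom] at h2
  simp only [extAct, actR, Ext.right_hom, comp_whiskerRight, Category.assoc]
  rw [h1, whiskerLeft_comp_assoc, reassoc_of% h, reassoc_of% h2]
  simp only [whiskerLeft_comp]

/-- Two runs are performed side by side by making all the steps of the first before those of the
second. -/
theorem Run.tensor {Z₁ Z₂ A₁ A₂ B₁ B₂ : SDot V} {h₁ : Z₁ ⊗ A₁ ⟶ B₁} {h₂ : Z₂ ⊗ A₂ ⟶ B₂}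
    (hh₁ : Run h₁) (hh₂ : Run h₂) : Run (tensorμ Z₁ Z₂ A₁ A₂ ≫ (h₁ ⊗ₘ h₂)) := by
  induction hh₁ with
  | step S e _ ih =>
    rw [← whiskerRight_comp_tensorHom, ← Category.assoc, ← extAct_left_tensorμ, Category.assoc]
    exact .step (.andL S _) (.left e _) ih
  | @done A₁ hA₁ =>
    rename_i B₁
    induction hh₂ with
    | step S e _ ih =>
      rw [← whiskerLeft_comp_tensorHom, ← Category.assoc, ← extAct_right_tensorμ, Category.assoc]
      exact .step (.andR _ S) (.right _ e) ih
    | @done A₂ hA₂ =>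
      have h : tensorμ B₁ B₂ (𝟙_ _) (𝟙_ _) ≫ ((ρ_ B₁).hom ▷ _ ≫ _ ◁ (ρ_ B₂).hom) =
          (B₁ ⊗ B₂) ◁ (λ_ _).hom ≫ (ρ_ _).hom := by
        refine Str.eq_of_satG (by unfold tensorμ; repeat constructor)
          (by repeat constructor) fun p q => ?_
        simp only [tensorμ, satG_comp, satG_whiskerLeft, satG_whiskerRight, satG_assoc_hom,
          satG_assoc_inv, satG_braiding, satG_rightUnitor_hom, satG_leftUnitor_hom, exists_col,
          exists_colUnit, cfst_cmk, csnd_cmk, col_ext, colUnit_ext]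
        grind
      rw [← tensorHom_comp_tensorHom, ← tensorμ_natural_right_assoc,
        MonoidalCategory.tensorHom_def (ρ_ B₁).hom, h, ← whiskerLeft_comp_assoc,
        ← trivIso_tensor (hA₁.tensor hA₂)]
      exact .done (hA₁.tensor hA₂)

/-- The formula in which every atom `x ≤ y` is replaced by `x ≤ x`. -/
def base : SDot V → SDot V
  | le x _ => le x x
  | top => 𝟙_ (SDot V)
  | and A B => base A ⊗ base B

/-- The reflexivities of all atoms of `base B`. -/
def init : ∀ B : SDot V, 𝟙_ (SDot V) ⟶ base B
  | le x _ => rHom x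
  | top => 𝟙 (𝟙_ (SDot V))
  | and A B => (λ_ (𝟙_ (SDot V))).inv ≫ (init A ⊗ₘ init B)

/-- Each atom `x ≤ y` of `B` is rebuilt from `x ≤ x`, and the equation of `t` with `r` on the left
makes the result the identity. -/
theorem exists_run_id (B : SDot V) :
    ∃ k : base B ⊗ B ⟶ B, Run k ∧ (λ_ B).inv ≫ init B ▷ B ≫ k = 𝟙 B := by
  induction B with
  | le x y =>
    -- One step: the atom `x ≤ y` replaces the whole right-hand side of `x ≤ x`.
    refine ⟨_, .step (.le x .here) .here (.done triv_unit), ?_⟩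
    have h : (λ_ (le x y)).inv ≫ rHom x ▷ le x y ≫ tHom x x y = 𝟙 _ := by
      rw [rHom_tHom_left, Iso.inv_hom_id]
    simpa [extAct, Ext.here_hom, ZRep.map, TRep.map, leAct, trivIso_unit, init, base] using h
  | top =>
    refine ⟨_, .done (B := 𝟙_ (SDot V)) triv_unit, ?_⟩
    change (λ_ (𝟙_ (SDot V))).inv ≫ 𝟙 (𝟙_ (SDot V)) ▷ 𝟙_ (SDot V) ≫ 𝟙_ (SDot V) ◁ 𝟙 _ ≫ _ = 𝟙 _
    simp [unitors_inv_equal]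
  | and A B ihA ihB =>
    obtain ⟨k₁, hk₁, h₁⟩ := ihA
    obtain ⟨k₂, hk₂, h₂⟩ := ihB
    refine ⟨_, hk₁.tensor hk₂, ?_⟩
    have h : (λ_ (A ⊗ B)).inv ≫ (λ_ (𝟙_ _)).inv ▷ (A ⊗ B) ≫ tensorμ (𝟙_ _) (𝟙_ _) A B =
        (λ_ A).inv ▷ B ≫ _ ◁ (λ_ B).inv := by
      refine Str.eq_of_satG (by unfold tensorμ; repeat constructor)
        (by repeat constructor) fun p q => ?_
      simp only [tensorμ, satG_comp, satG_whiskerLeft, satG_whiskerRight, satG_assoc_hom,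
        satG_assoc_inv, satG_braiding, satG_leftUnitor_inv, exists_col,
        exists_colUnit, cfst_cmk, csnd_cmk, col_ext, colUnit_ext]
      grind
    change (λ_ (A ⊗ B)).inv ≫ ((λ_ (𝟙_ _)).inv ≫ (init A ⊗ₘ init B)) ▷ (A ⊗ B) ≫
      tensorμ (base A) (base B) A B ≫ (k₁ ⊗ₘ k₂) = 𝟙 (A ⊗ B)
    rw [comp_whiskerRight, Category.assoc, tensorμ_natural_left_assoc, reassoc_of% h,
      ← Category.assoc (_ ▷ B), ← MonoidalCategory.tensorHom_def]
    simp only [tensorHom_comp_tensorHom, h₁, h₂, id_tensorHom_id]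

/-! ## Diagrams of runs -/

section diagrams

variable {u v : SDotTerm V} {Z Z₁ A A₁ B : SDot V}

theorem satG_extAct (S : ZRep u v Z Z₁) (e : Ext (le u v) A A₁) (p q) :
    SatG (extAct S.map e) p q ↔ S.part (cfst p) = leFst (e.part (csnd p)) ∧
      cfst q = S.upd (cfst p) (leSnd (e.part (csnd p))) ∧ csnd q = e.rest (csnd p) := by
  simp [extAct, S.satG_map, exists_col]
  grind

/-- Together with `satG_extAct_unique` this makes a step a surjective partial function on
colourings, which is why a common first step can be cancelled. -/
theorem exists_satG_extAct (S : ZRep u v Z Z₁) (e : Ext (le u v) A A₁) (q) :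
    ∃ p, SatG (extAct S.map e) p q := by
  obtain ⟨z, c, -, hz⟩ := S.exists_upd (cfst q) fun _ => True
  exact ⟨cmk z (e.mk (mkLe (S.part z) c) (csnd q)),
    by simp [satG_extAct, leFst_mk, leSnd_mk, hz]⟩

theorem satG_extAct_unique {S : ZRep u v Z Z₁} {e : Ext (le u v) A A₁} {p q q'}
    (h : SatG (extAct S.map e) p q) (h' : SatG (extAct S.map e) p q') : q = q' := by
  rw [satG_extAct] at h h'
  rw [SDot.col_ext, h.2.1, h.2.2, h'.2.1, h'.2.2]
  exact ⟨rfl, rfl⟩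

theorem str_trivIso : ∀ {A : SDot V} (h : Triv A), Str (trivIso h).hom
  | top, _ => .id _
  | and _ _, h => by
    change Str (((trivIso h.1).hom ⊗ₘ (trivIso h.2).hom) ≫ (λ_ _).hom)
    rw [MonoidalCategory.tensorHom_def]
    exact (((str_trivIso h.1).whiskerRight _).comp ((str_trivIso h.2).whiskerLeft _)).comp
      (.leftUnitor_hom _)

/-- Every colouring of the first conjunct of the source of a run extends to the whole diagram. -/
theorem Run.exists_satG_fst {h : Z ⊗ A ⟶ B} (hh : Run h) (z : Col Z) :
    ∃ a q, SatG h (cmk z a) q := by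
  induction hh with
  | done hA => exact ⟨fun _ => True, (((str_trivIso hA).whiskerLeft _).comp
      (.rightUnitor_hom _)).exists_satG _⟩
  | step S e _ ih =>
    -- The colour of the right-hand side of the atom is free, and `True` is chosen; that of the
    -- left-hand side is then forced by the link to be `S.part z`.
    obtain ⟨a, q, h⟩ := ih (S.upd z fun _ => True)
    refine ⟨e.mk (mkLe (S.part z) fun _ => True) a, q, (satG_comp _ _ _ _).2 ⟨_, ?_, h⟩⟩
    simp [satG_extAct, leFst_mk, leSnd_mk]

/-- The colourings agree on the left-hand sides of atoms. -/
def AgreeLeft : ∀ {A : SDot V}, Col A → Col A → Prop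
  | le _ _, p, q => leFst p = leFst q
  | top, _, _ => True
  | and _ _, p, q => AgreeLeft (andFst p) (andFst q) ∧ AgreeLeft (andSnd p) (andSnd q)

theorem agreeLeft_of_triv : ∀ {A : SDot V}, Triv A → ∀ p q : Col A, AgreeLeft p q
  | top, _, _, _ => trivial
  | and _ _, h, _, _ => ⟨agreeLeft_of_triv h.1 _ _, agreeLeft_of_triv h.2 _ _⟩

theorem Ext.agreeLeft_iff (e : Ext (le u v) A A₁) (p q : Col A) :
    AgreeLeft p q ↔ leFst (e.part p) = leFst (e.part q) ∧ AgreeLeft (e.rest p) (e.rest q) := by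
  have h : ∀ {A B : SDot V} (p q : Col (A ⊗ B)), AgreeLeft p q ↔
    AgreeLeft (cfst p) (cfst q) ∧ AgreeLeft (csnd p) (csnd q) := fun _ _ => Iff.rfl
  induction e with
  | here => exact (and_iff_left trivial).symm
  | left e B ih => simp [h, ih, part, rest, and_assoc]
  | right B e ih =>
    simp [h, ih, part, rest]
    tauto

/-- Every colouring of the left-hand sides of the atoms in the second conjunct of the source of a
run extends to the whole diagram. -/
theorem Run.exists_satG_snd {h : Z ⊗ A ⟶ B} (hh : Run h) (w : Col A) :
    ∃ z a q, AgreeLeft a w ∧ SatG h (cmk z a) q := by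
  induction hh with
  | done hA =>
    obtain ⟨q, hq⟩ := (((str_trivIso hA).whiskerLeft _).comp (.rightUnitor_hom _)).exists_satG
      (cmk (fun _ => True) w)
    exact ⟨_, w, q, agreeLeft_of_triv hA _ _, hq⟩
  | step S e _ ih =>
    obtain ⟨z₁, a₁, q, h1, h2⟩ := ih (e.rest w)
    -- The replaced occurrence in `Z` takes the prescribed colour of the left-hand side linked to
    -- it; `z₁` puts no constraint on it.
    obtain ⟨z, c, h3, h4⟩ := S.exists_upd z₁ (leFst (e.part w))
    refine ⟨z, e.mk (mkLe (S.part z) c) a₁, q, ?_, (satG_comp _ _ _ _).2 ⟨_, ?_, h2⟩⟩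
    · simp [e.agreeLeft_iff, leFst_mk, h3, h1]
    · simp [satG_extAct, leFst_mk, leSnd_mk, h4]

/-- Two occurrences of atoms are equal or disjoint. -/
theorem Ext.eq_or_commute {u' v' : SDotTerm V} {A₂ : SDot V} (e : Ext (le u v) A A₁)
    (e' : Ext (le u' v') A A₂) :
    (∃ (_ : u = u') (_ : v = v') (_ : A₁ = A₂), HEq e e') ∨
    ∃ (A₃ : SDot V) (d' : Ext (le u' v') A₁ A₃) (d : Ext (le u v) A₂ A₃),
      ∀ p, d'.part (e.rest p) = e'.part p ∧ d.part (e'.rest p) = e.part p ∧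
        d'.rest (e.rest p) = d.rest (e'.rest p) := by
  induction e generalizing A₂ with
  | here =>
    cases e'
    exact .inl ⟨rfl, rfl, rfl, HEq.rfl⟩
  | left e B ih =>
    cases e' with
    | left e' =>
      rcases ih e' with ⟨rfl, rfl, rfl, h⟩ | ⟨A₃, d', d, h⟩
      · cases h
        exact .inl ⟨rfl, rfl, rfl, HEq.rfl⟩
      · exact .inr ⟨_, d'.left B, d.left B, fun p => by simp [part, rest, h]⟩
    | right _ e' => exact .inr ⟨_, .right _ e', .left e _, fun p => by simp [part, rest]⟩
  | right B e ih =>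
    cases e' with
    | left e' => exact .inr ⟨_, .left e' _, .right _ e, fun p => by simp [part, rest]⟩
    | right _ e' =>
      rcases ih e' with ⟨rfl, rfl, rfl, h⟩ | ⟨A₃, d', d, h⟩
      · cases h
        exact .inl ⟨rfl, rfl, rfl, HEq.rfl⟩
      · exact .inr ⟨_, d'.right B, d.right B, fun p => by simp [part, rest, h]⟩

end diagrams

/-- Actions of disjoint occurrences commute. -/
theorem extAct_commute {X Y Z Z₁ Z₂ W A A₁ A₂ A₃ : SDot V} {m : Z ⊗ X ⟶ Z₁} {m' : Z ⊗ Y ⟶ Z₂}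
    {n' : Z₁ ⊗ Y ⟶ W} {n : Z₂ ⊗ X ⟶ W} (hm : act m n' = Z ◁ (β_ X Y).hom ≫ act m' n)
    {e : Ext X A A₁} {e' : Ext Y A A₂} {d' : Ext Y A₁ A₃} {d : Ext X A₂ A₃}
    (h : ∀ p, d'.part (e.rest p) = e'.part p ∧ d.part (e'.rest p) = e.part p ∧
        d'.rest (e.rest p) = d.rest (e'.rest p)) :
    extAct m e ≫ extAct n' d' = extAct m' e' ≫ extAct n d := by
  -- Extracting the two conjuncts in either order is the same up to a braiding, by structural
  -- coherence.
  have key : e.iso.hom ≫ X ◁ d'.iso.hom ≫ (α_ _ _ _).inv ≫ (β_ X Y).hom ▷ A₃ =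
      e'.iso.hom ≫ Y ◁ d.iso.hom ≫ (α_ _ _ _).inv := by
    refine Str.eq_of_satG (by repeat first | exact Ext.str _ | constructor)
      (by repeat first | exact Ext.str _ | constructor) fun p q => ?_
    simp [exists_col]
    grind
  have hact : ∀ {X Y Z₁ A₁ : SDot V} (m : Z ⊗ X ⟶ Z₁) (n : Z₁ ⊗ Y ⟶ W) (e : Ext X A A₁)
      (d : Ext Y A₁ A₃), extAct m e ≫ extAct n d =
        Z ◁ (e.iso.hom ≫ X ◁ d.iso.hom ≫ (α_ _ _ _).inv) ≫ (α_ _ _ _).inv ≫ act m n ▷ A₃ := by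
    intro X Y Z₁ A₁ m n e d
    simp only [extAct, act, Category.assoc]
    rw [← whisker_exchange_assoc]
    simp
  rw [hact, hact, hm, ← key]
  simp

/-- If the diagram of a run links an occurrence in the first conjunct of the source with the
left-hand side of an atom in the second conjunct, then the run may begin with that atom. -/
theorem Run.exists_step {Z A B : SDot V} {h : Z ⊗ A ⟶ B} (hh : Run h) {u v : SDotTerm V}
    {Z₁ A₁ : SDot V} (S : ZRep u v Z Z₁) (e : Ext (le u v) A A₁)
    (link : ∀ p q, SatG h p q → S.part (cfst p) = leFst (e.part (csnd p))) :
    ∃ h₁ : Z₁ ⊗ A₁ ⟶ B, Run h₁ ∧ h = extAct S.map e ≫ h₁ := by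
  induction hh generalizing Z₁ A₁ with
  | done hA => exact absurd hA e.not_triv
  | step S' e' hh ih =>
    rename_i u' v' Z Z₂ A A₂ h₂
    have hrun := Run.step S' e' hh
    have link' : ∀ p q, SatG (extAct S'.map e' ≫ h₂) p q →
        S'.part (cfst p) = leFst (e'.part (csnd p)) := by
      intro p q hpq
      obtain ⟨s, hs, -⟩ := (satG_comp _ _ _ _).1 hpq
      exact ((satG_extAct _ _ _ _).1 hs).1
    rcases e.eq_or_commute e' with ⟨rfl, rfl, rfl, he⟩ | ⟨A₃, d', d, hd⟩
    · cases he
      -- The first step uses the same atom. Both occurrences are linked to its left-hand side, and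
      -- every colouring of `Z` extends to the diagram, so the occurrences coincide.
      cases S.eq_of_part S' fun z => by
        obtain ⟨a, q, hq⟩ := hrun.exists_satG_fst z
        simpa using (link _ _ hq).trans (link' _ _ hq).symm
      exact ⟨h₂, hh, rfl⟩
    -- The first step uses another atom. The left-hand sides of the two atoms can be coloured `True`
    -- and `False`, and the links carry these colours to `S` and `S'`, which are therefore disjoint.
    · obtain ⟨W, T', T, hT, hpart⟩ := S.exists_commute S' (by
        obtain ⟨z, a, q, ha, hq⟩ := hrun.exists_satG_snd
          (e.mk (mkLe (fun _ => True) fun _ => True)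
            (d'.mk (mkLe (fun _ => False) fun _ => True) fun _ => True))
        have h1 := link _ _ hq
        have h2 := link' _ _ hq
        have h3 := ((e.agreeLeft_iff _ _).1 ha).1
        have h4 := ((e'.agreeLeft_iff _ _).1 ha).1
        rw [← (hd (e.mk _ _)).1, Ext.rest_mk, Ext.part_mk, leFst_mk] at h4
        simp only [cfst_cmk, csnd_cmk, Ext.part_mk, leFst_mk] at h1 h2 h3
        exact ⟨z, h1.trans h3, h2.trans h4⟩)
      -- The link persists in the remaining run: every colouring of it extends backwards over the
      -- first step, which alters neither the occurrence nor the atom in question.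
      obtain ⟨h₃, hh₃, rfl⟩ := ih T d (by
        intro p q hpq
        obtain ⟨p', hp'⟩ := exists_satG_extAct S' e' p
        have h1 := link p' q ((satG_comp _ _ _ _).2 ⟨_, hp', hpq⟩)
        obtain ⟨-, h2, h3⟩ := (satG_extAct _ _ _ _).1 hp'
        rw [h2, h3, hpart, (hd _).2.1, h1])
      exact ⟨_, .step T' d' hh₃, by
        rw [← Category.assoc, ← extAct_commute hT hd, Category.assoc]⟩

/-- Runs with the same diagram are equal. -/
theorem Run.eq_of_satG {Z A B : SDot V} {h h' : Z ⊗ A ⟶ B} (hh : Run h) (hh' : Run h')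
    (hs : ∀ p q, SatG h p q ↔ SatG h' p q) : h = h' := by
  induction hh with
  | done hA =>
    cases hh' with
    | done => rfl
    | step S e => exact absurd hA e.not_triv
  | step S e hh ih =>
    -- The link created by the first step of `h` belongs to the common diagram, so `h'` may begin
    -- with the same step.
    obtain ⟨h₁, hh₁, rfl⟩ := hh'.exists_step S e (by
      intro p q hpq
      obtain ⟨s, hs, -⟩ := (satG_comp _ _ _ _).1 ((hs _ _).2 hpq)
      exact ((satG_extAct _ _ _ _).1 hs).1)
    rw [ih hh₁ fun p q => ?_]
    obtain ⟨p', hp'⟩ := exists_satG_extAct S e p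
    -- Since `p'` leads to `p` and to nothing else, the condition on the composite at `p'` is the
    -- condition on `k` at `p`.
    have key : ∀ k, SatG (extAct S.map e ≫ k) p' q ↔ SatG k p q := by
      intro k
      rw [satG_comp]
      exact ⟨fun ⟨s, h1, h2⟩ => satG_extAct_unique h1 hp' ▸ h2, fun h1 => ⟨_, hp', h1⟩⟩
    rw [← key, hs, key]

/-- Arrows with the same diagram are equal. -/
theorem eq_of_map_eq {A B : SDot V} {f g : A ⟶ B} (h : (G V).map f = (G V).map g) : f = g := by
  obtain ⟨k, hk, hid⟩ := exists_run_id B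
  have key : base B ◁ f ≫ k = base B ◁ g ≫ k := by
    refine (hk.comp f).eq_of_satG (hk.comp g) fun p q => ?_
    simp only [satG_comp, satG_whiskerLeft, satG_of_map_eq h]
  -- The reflexivities `init B` act on the other tensor factor, so they slide past `f` and complete
  -- `k` to the identity of `B`.
  have recover : ∀ f : A ⟶ B, f = (λ_ A).inv ≫ init B ▷ A ≫ base B ◁ f ≫ k := by
    intro f
    rw [← whisker_exchange_assoc, ← reassoc_of% leftUnitor_inv_naturality f, hid,
      Category.comp_id]
  rw [recover f, key, ← recover g]

end SDot

theorem mainTheorem6 (V : Type*) : (SDot.G V).Faithful :=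
  ⟨fun h => SDot.eq_of_map_eq h⟩
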